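/- Let $K$ be a field, $C$ a $K$-coalgebra and $e=e*e\in C^*$ an idempotent for the convolution product. Comodules are right comodules; $\mathcal M^C$ is their category. For $M\in\mathcal M^C$ put $e\,m=\sum m_{(0)}e(m_{(1)})$, and for $c\in C$ put $e\,c=\sum c_{(1)}e(c_{(2)})$ and $c\,e=\sum e(c_{(1)})c_{(2)}$. Then $eCe$ is a coalgebra with comultiplication $exe\mapsto\sum ex_{(1)}e\otimes ex_{(2)}e$ and counit the restriction of that of $C$, and $Ce$ is an $(eCe,C)$-bicomodule. Let $$T=e(-):\mathcal M^C\to\mathcal M^{eCe},\qquad S=-\,\square_{eCe}\,Ce:\mathcal M^{eCe}\to\mathcal M^C$$ be the quotient functor and the section functor. A $C$-comodule $M$ is torsion if $T(M)=0$, and torsion-free if it has no nonzero torsion subcomodule. A comodule $M$ is quasi-finite if $\mathrm{Hom}(F,M)$ is finite-dimensional over $K$ for every finite-dimensional comodule $F$; $\mathcal M_{qf}$ denotes the full subcategory of quasi-finite comodules. $\mathrm{Soc}\,M$ is the sum of the simple subcomodules of $M$. Let $\{S_x\}_{x\in I_C}$ be a complete set of pairwise non-isomorphic simple $C$-comodules,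 and $I_e=\{x\in I_C : T(S_x)\neq 0\}$. Then $\{T(S_x)\}_{x\in I_e}$ is a complete set of pairwise non-isomorphic simple $eCe$-comodules; for $x\in I_e$ one also writes $S_x$ for $T(S_x)$. Let $E_x$ be an injective envelope of $S_x$ in $\mathcal M^C$ and, for $x\in I_e$, let $\overline E_x$ be an injective envelope of $T(S_x)$ in $\mathcal M^{eCe}$. The following hold. (a) $S$ preserves injective comodules. (b) If $N$ is a quasi-finite indecomposable $eCe$-comodule, then $S(N)$ is indecomposable. (c) $S$ preserves indecomposable injective comodules. (d) If $Y$ is a simple $eCe$-comodule and $Y\cong T(S_x)$, then $\mathrm{Soc}\,S(Y)\cong S_x$. (e) If $Y$ is a simple $eCe$-comodule, then $S(Y)$ is torsion-free. (f) $S(\overline E_x)\cong E_x$ for all $x\in I_e$. (g) $S$ preserves quasi-finite comodules. (h) $S$ restricts to a functor $\mathcal M^{eCe}_{qf}\to\mathcal M^{C}_{qf}$ which is full and faithful, preserves indecomposable comodules, and respects isomorphism classes: for quasi-finite $N,N'$, $S(N)\cong S(N')$ if and only if $N\cong N'$. -/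

import Mathlib

open CategoryTheory
open scoped TensorProduct

universe u v w

noncomputable section

namespace ComodLoc

/-! ### Linear-algebra helper facts about coassociativity squares -/

section CoassocSquares

variable {K : Type*} [Field K]
  {Y Z V W U Y' Z' V' W' U' : Type*}
  [AddCommGroup Y] [Module K Y] [AddCommGroup Z] [Module K Z]
  [AddCommGroup V] [Module K V] [AddCommGroup W] [Module K W] [AddCommGroup U] [Module K U]
  [AddCommGroup Y'] [Module K Y'] [AddCommGroup Z'] [Module K Z']
  [AddCommGroup V'] [Module K V'] [AddCommGroup W'] [Module K W'] [AddCommGroup U'] [Module K U']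

theorem assoc_rTensor_map {β : Y →ₗ[K] V ⊗[K] W} {β' : Y' →ₗ[K] V' ⊗[K] W'}
    {y : Y →ₗ[K] Y'} {z : Z →ₗ[K] Z'} {v : V →ₗ[K] V'} {w : W →ₗ[K] W'}
    (h : ∀ b, β' (y b) = TensorProduct.map v w (β b)) (t : Y ⊗[K] Z) :
    TensorProduct.assoc K V' W' Z' (β'.rTensor Z' (TensorProduct.map y z t)) =
      TensorProduct.map v (TensorProduct.map w z)
        (TensorProduct.assoc K V W Z (β.rTensor Z t)) := by
  induction t with
  | zero => simp
  | add a b ha hb => simp only [map_add, ha, hb]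
  | tmul b c =>
    simp only [TensorProduct.map_tmul, LinearMap.rTensor_tmul, h]
    rw [TensorProduct.map_map_assoc, TensorProduct.map_tmul]

theorem lTensor_map {γ : U →ₗ[K] W ⊗[K] Z} {γ' : U' →ₗ[K] W' ⊗[K] Z'}
    {v : V →ₗ[K] V'} {w : W →ₗ[K] W'} {z : Z →ₗ[K] Z'} {u : U →ₗ[K] U'}
    (h : ∀ b, γ' (u b) = TensorProduct.map w z (γ b)) (t : V ⊗[K] U) :
    γ'.lTensor V' (TensorProduct.map v u t) =
      TensorProduct.map v (TensorProduct.map w z) (γ.lTensor V t) := by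
  induction t with
  | zero => simp
  | add a b ha hb => simp only [map_add, ha, hb]
  | tmul b c => simp [h]

end CoassocSquares

/-! ### Right comodules -/

/-- A right comodule over the `K`-coalgebra `C`. -/
structure RightComod (K : Type u) (C : Type v) [Field K] [AddCommGroup C] [Module K C]
    [Coalgebra K C] where
  carrier : Type v
  [addCommGroup : AddCommGroup carrier]
  [module : Module K carrier]
  /-- the coaction `M → M ⊗ C` -/
  coact : carrier →ₗ[K] carrier ⊗[K] C
  coassoc : ∀ m, TensorProduct.assoc K carrier C C (coact.rTensor C (coact m)) =
    (CoalgebraStruct.comul : C →ₗ[K] C ⊗[K] C).lTensor carrier (coact m)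
  counit : ∀ m, (CoalgebraStruct.counit : C →ₗ[K] K).lTensor carrier (coact m) = m ⊗ₜ[K] 1

namespace RightComod

variable {K : Type u} {C : Type v} [Field K] [AddCommGroup C] [Module K C] [Coalgebra K C]

instance : CoeSort (RightComod K C) (Type v) := ⟨RightComod.carrier⟩

instance (M : RightComod K C) : AddCommGroup M := M.addCommGroup
instance (M : RightComod K C) : Module K M := M.module

/-- The `K`-space `Hom_C(M, N)` of comodule morphisms, inside the space of `K`-linear maps. -/
def homs (M N : RightComod K C) : Submodule K (M →ₗ[K] N) where
  carrier := {f | ∀ m, N.coact (f m) = f.rTensor C (M.coact m)}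
  add_mem' {f g} hf hg m := by
    simp [LinearMap.rTensor_add, hf m, hg m]
  zero_mem' m := by simp
  smul_mem' c f hf m := by
    simp [LinearMap.rTensor_smul, hf m]

/-- The category of right `C`-comodules. -/
instance : Category (RightComod K C) where
  Hom M N := ↥(homs M N)
  id M := ⟨LinearMap.id, fun m => by simp⟩
  comp {L M N} f g := ⟨g.1 ∘ₗ f.1, fun m => by
    have h1 := f.2 m
    have h2 := g.2 (f.1 m)
    rw [LinearMap.comp_apply, h2, h1, LinearMap.rTensor_comp, LinearMap.comp_apply]⟩

/-- The linear map underlying a morphism of comodules. -/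
def lin {M N : RightComod K C} (f : M ⟶ N) : M →ₗ[K] N := Subtype.val f

/-- The morphism of comodules given by a colinear map. -/
def ofLin {M N : RightComod K C} (f : M →ₗ[K] N)
    (hf : ∀ m, N.coact (f m) = f.rTensor C (M.coact m)) : M ⟶ N := ⟨f, hf⟩

theorem lin_coact {M N : RightComod K C} (f : M ⟶ N) (m : M) :
    N.coact (lin f m) = (lin f).rTensor C (M.coact m) := Subtype.property f m

@[ext] theorem hom_ext {M N : RightComod K C} {f g : M ⟶ N} (h : lin f = lin g) : f = g :=
  Subtype.ext h

@[simp] theorem lin_id (M : RightComod K C) : lin (𝟙 M) = LinearMap.id := rfl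

@[simp] theorem lin_comp {L M N : RightComod K C} (f : L ⟶ M) (g : M ⟶ N) :
    lin (f ≫ g) = lin g ∘ₗ lin f := rfl

@[simp] theorem lin_ofLin {M N : RightComod K C} (f : M →ₗ[K] N)
    (hf : ∀ m, N.coact (f m) = f.rTensor C (M.coact m)) : lin (ofLin f hf) = f := rfl

/-! ### Subcomodules -/

/-- A subspace `W` of `M` is a subcomodule if the coaction maps `W` into `W ⊗ C`. -/
def IsSubcomodule (M : RightComod K C) (W : Submodule K M) : Prop :=
  ∀ m ∈ W, M.coact m ∈ LinearMap.range (W.subtype.rTensor C)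

theorem subtype_rTensor_injective (M : RightComod K C) (W : Submodule K M) :
    Function.Injective (W.subtype.rTensor C) :=
  Module.Flat.rTensor_preserves_injective_linearMap _ W.injective_subtype

/-- The coaction restricted to a subcomodule. -/
def restrictCoact (M : RightComod K C) (W : Submodule K M) (h : M.IsSubcomodule W) :
    W →ₗ[K] W ⊗[K] C :=
  (LinearEquiv.ofInjective (W.subtype.rTensor C) (M.subtype_rTensor_injective W)).symm.toLinearMap
    ∘ₗ (M.coact ∘ₗ W.subtype).codRestrict _ (fun w => h w w.2)

theorem restrictCoact_spec (M : RightComod K C) (W : Submodule K M) (h : M.IsSubcomodule W)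
    (w : W) : W.subtype.rTensor C (M.restrictCoact W h w) = M.coact w := by
  have := LinearEquiv.apply_symm_apply
    (LinearEquiv.ofInjective (W.subtype.rTensor C) (M.subtype_rTensor_injective W))
    ((M.coact ∘ₗ W.subtype).codRestrict _ (fun w => h w w.2) w)
  exact congrArg Subtype.val this

/-- A subcomodule, as a comodule. -/
def sub (M : RightComod K C) (W : Submodule K M) (h : M.IsSubcomodule W) : RightComod K C where
  carrier := W
  coact := M.restrictCoact W h
  coassoc w := by
    have inj : Function.Injective
        (TensorProduct.map W.subtype (TensorProduct.map LinearMap.id LinearMap.id) :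
          W ⊗[K] (C ⊗[K] C) →ₗ[K] M ⊗[K] (C ⊗[K] C)) := by
      rw [TensorProduct.map_id]
      exact Module.Flat.rTensor_preserves_injective_linearMap _ W.injective_subtype
    apply inj
    rw [← assoc_rTensor_map (β' := M.coact) (y := W.subtype) (fun b => ?_),
      ← lTensor_map (γ' := CoalgebraStruct.comul) (u := LinearMap.id) (fun b => ?_)]
    · have := M.restrictCoact_spec W h w
      rw [LinearMap.rTensor] at this
      rw [this, M.coassoc]
    · simp
    · exact (M.restrictCoact_spec W h b).symm
  counit w := by
    have inj : Function.Injective (W.subtype.rTensor K) :=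
      Module.Flat.rTensor_preserves_injective_linearMap _ W.injective_subtype
    apply inj
    have h1 := M.counit w
    rw [← M.restrictCoact_spec W h w] at h1
    rw [← LinearMap.comp_apply, LinearMap.rTensor_comp_lTensor, ← LinearMap.lTensor_comp_rTensor,
      LinearMap.comp_apply, h1]
    simp

/-- The restriction of a comodule morphism to subcomodules. -/
def subMap {M M' : RightComod K C} (f : M ⟶ M') {W : Submodule K M} {W' : Submodule K M'}
    (h : M.IsSubcomodule W) (h' : M'.IsSubcomodule W') (hf : ∀ w ∈ W, lin f w ∈ W') :
    M.sub W h ⟶ M'.sub W' h' :=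
  ofLin (M := M.sub W h) (N := M'.sub W' h') ((lin f).restrict hf) fun w => by
    apply M'.subtype_rTensor_injective W'
    refine (M'.restrictCoact_spec W' h' ((lin f).restrict hf w)).trans ?_
    have h1 := M.restrictCoact_spec W h w
    have h2 := lin_coact f w.1
    rw [← h1] at h2
    refine h2.trans ?_
    rw [← LinearMap.comp_apply, ← LinearMap.rTensor_comp]
    change _ = (W'.subtype.rTensor C) (((lin f).restrict hf).rTensor C (M.restrictCoact W h w))
    rw [← LinearMap.comp_apply, ← LinearMap.rTensor_comp]
    rfl

/-- The kernel of a linear map compatible with coactions is a subcomodule. -/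
theorem isSubcomodule_ker (M : RightComod K C) {P : Type*} [AddCommGroup P] [Module K P]
    (f : M →ₗ[K] P) (ρ : P →ₗ[K] P ⊗[K] C) (hf : ∀ m, ρ (f m) = f.rTensor C (M.coact m)) :
    M.IsSubcomodule (LinearMap.ker f) := by
  intro m hm
  have ex : Function.Exact (LinearMap.ker f).subtype f := LinearMap.exact_subtype_ker_map f
  have ex' := Module.Flat.rTensor_exact C ex
  refine (ex' _).1 ?_
  rw [← hf, LinearMap.mem_ker.1 hm, map_zero]

/-- A comodule is simple if it is nonzero and has no proper nonzero subcomodules. -/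
def IsSimple (M : RightComod K C) : Prop :=
  Nontrivial M ∧ ∀ W : Submodule K M, M.IsSubcomodule W → W = ⊥ ∨ W = ⊤

/-- A comodule is indecomposable if it is nonzero and is not the direct sum of two nonzero
subcomodules. -/
def IsIndecomposable (M : RightComod K C) : Prop :=
  Nontrivial M ∧ ∀ W W' : Submodule K M, M.IsSubcomodule W → M.IsSubcomodule W' →
    IsCompl W W' → W = ⊥ ∨ W' = ⊥

/-- The subspace underlying the socle: the sum of all simple subcomodules. -/
def socleSubmodule (M : RightComod K C) : Submodule K M :=
  sSup {W | ∃ h : M.IsSubcomodule W, (M.sub W h).IsSimple}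

theorem isSubcomodule_sSup (M : RightComod K C) (s : Set (Submodule K M))
    (hs : ∀ W ∈ s, M.IsSubcomodule W) : M.IsSubcomodule (sSup s) := by
  have key : sSup s ≤ (LinearMap.range ((sSup s).subtype.rTensor C)).comap M.coact := by
    refine sSup_le fun W hW m hm => ?_
    obtain ⟨t, ht⟩ := hs W hW m hm
    refine ⟨(Submodule.inclusion (le_sSup hW)).rTensor C t, ?_⟩
    rw [← ht, ← LinearMap.comp_apply, ← LinearMap.rTensor_comp, Submodule.subtype_comp_inclusion]
  exact fun m hm => key hm

/-- The socle of a comodule. -/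
def socle (M : RightComod K C) : RightComod K C :=
  M.sub M.socleSubmodule (M.isSubcomodule_sSup _ fun _ hW => hW.1)

/-- `M` is quasi-finite if `Hom_C(F, M)` is finite-dimensional for every finite-dimensional
comodule `F`. -/
def IsQuasiFinite : ObjectProperty (RightComod K C) := fun M =>
  ∀ F : RightComod K C, Module.Finite K F → Module.Finite K (homs F M)

/-- The morphism `j : M ⟶ E` is an injective envelope: `E` is an injective object, `j` is
injective, and every subcomodule of `E` that meets the image of `j` trivially is zero. -/
structure IsInjectiveEnvelope {M E : RightComod K C} (j : M ⟶ E) : Prop where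
  injective_obj : Injective E
  injective_map : Function.Injective (lin j)
  essential : ∀ W : Submodule K E, E.IsSubcomodule W → W ⊓ LinearMap.range (lin j) = ⊥ → W = ⊥

/-- The family `S` is a complete set of pairwise non-isomorphic simple comodules. -/
structure IsCompleteSimples {I : Type*} (S : I → RightComod K C) : Prop where
  simple : ∀ x, (S x).IsSimple
  pairwise : ∀ x y, Nonempty (S x ≅ S y) → x = y
  complete : ∀ Y : RightComod K C, Y.IsSimple → ∃ x, Nonempty (Y ≅ S x)

end RightComod

/-! ### Bicomodules and the cotensor product -/

/-- A `(D, C)`-bicomodule: a left `D`-comodule and right `C`-comodule whose coactions commute. -/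
structure Bicomod (K : Type u) (D C : Type v) [Field K] [AddCommGroup D] [Module K D]
    [Coalgebra K D] [AddCommGroup C] [Module K C] [Coalgebra K C] extends RightComod K C where
  /-- the left coaction `X → D ⊗ X` -/
  lcoact : carrier →ₗ[K] D ⊗[K] carrier
  lcoassoc : ∀ x, TensorProduct.assoc K D D carrier
      ((CoalgebraStruct.comul : D →ₗ[K] D ⊗[K] D).rTensor carrier (lcoact x)) =
    lcoact.lTensor D (lcoact x)
  lcounit : ∀ x, (CoalgebraStruct.counit : D →ₗ[K] K).rTensor carrier (lcoact x) = 1 ⊗ₜ[K] x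
  compat : ∀ x, TensorProduct.assoc K D carrier C (lcoact.rTensor C (coact x)) =
    coact.lTensor D (lcoact x)

section Cotensor

variable {K : Type u} {D C : Type v} [Field K] [AddCommGroup D] [Module K D]
    [Coalgebra K D] [AddCommGroup C] [Module K C] [Coalgebra K C]

/-- For a vector space `N` and a right comodule `X`, the right comodule `N ⊗ X` with coaction
`1 ⊗ ρ_X`. -/
def tensorComod (N : Type v) [AddCommGroup N] [Module K N] (X : RightComod K C) :
    RightComod K C where
  carrier := N ⊗[K] X
  coact := (TensorProduct.assoc K N X C).symm.toLinearMap ∘ₗ X.coact.lTensor N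
  coassoc t := by
    induction t with
    | zero => simp
    | add a b ha hb => simp only [map_add, ha, hb]
    | tmul n x =>
      have h := X.coassoc x
      have h1 : ∀ t : X ⊗[K] C,
          TensorProduct.assoc K (N ⊗[K] X) C C
            (((TensorProduct.assoc K N X C).symm.toLinearMap ∘ₗ X.coact.lTensor N).rTensor C
              ((TensorProduct.assoc K N X C).symm (n ⊗ₜ t))) =
            (TensorProduct.assoc K N X (C ⊗[K] C)).symm
              (n ⊗ₜ (TensorProduct.assoc K X C C (X.coact.rTensor C t))) := by
        intro t
        induction t with
        | zero => simp
        | add a b ha hb => simp only [map_add, TensorProduct.tmul_add, ha, hb]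
        | tmul x c =>
          simp only [TensorProduct.assoc_symm_tmul, LinearMap.rTensor_tmul, LinearMap.comp_apply,
            LinearMap.lTensor_tmul, LinearEquiv.coe_coe]
          generalize X.coact x = s
          induction s with
          | zero => simp
          | add a b ha hb => simp only [map_add, TensorProduct.tmul_add, TensorProduct.add_tmul,
              ha, hb]
          | tmul y d => simp
      have h2 : ∀ t : X ⊗[K] C,
          (CoalgebraStruct.comul : C →ₗ[K] C ⊗[K] C).lTensor (N ⊗[K] X)
            ((TensorProduct.assoc K N X C).symm (n ⊗ₜ t)) =
          (TensorProduct.assoc K N X (C ⊗[K] C)).symm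
            (n ⊗ₜ ((CoalgebraStruct.comul : C →ₗ[K] C ⊗[K] C).lTensor X t)) := by
        intro t
        induction t with
        | zero => simp
        | add a b ha hb => simp only [map_add, TensorProduct.tmul_add, ha, hb]
        | tmul x c => simp
      have h3 : ((TensorProduct.assoc K N X C).symm.toLinearMap ∘ₗ X.coact.lTensor N) (n ⊗ₜ x) =
          (TensorProduct.assoc K N X C).symm (n ⊗ₜ X.coact x) := by simp
      rw [h3, h1, h2, h]
  counit t := by
    induction t with
    | zero => simp
    | add a b ha hb => simp only [map_add, ha, hb, TensorProduct.add_tmul]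
    | tmul n x =>
      have h2 : ∀ t : X ⊗[K] C,
          (CoalgebraStruct.counit : C →ₗ[K] K).lTensor (N ⊗[K] X)
            ((TensorProduct.assoc K N X C).symm (n ⊗ₜ t)) =
          (TensorProduct.assoc K N X K).symm
            (n ⊗ₜ ((CoalgebraStruct.counit : C →ₗ[K] K).lTensor X t)) := by
        intro t
        induction t with
        | zero => simp
        | add a b ha hb => simp only [map_add, TensorProduct.tmul_add, ha, hb]
        | tmul x c => simp
      have h3 : ((TensorProduct.assoc K N X C).symm.toLinearMap ∘ₗ X.coact.lTensor N) (n ⊗ₜ x) =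
          (TensorProduct.assoc K N X C).symm (n ⊗ₜ X.coact x) := by simp
      rw [h3, h2, X.counit]
      simp

/-- The map `ρ_N ⊗ 1 - 1 ⊗ λ_X : N ⊗ X → N ⊗ (D ⊗ X)`. -/
def cotensorMap (N : RightComod K D) (X : Bicomod K D C) :
    N ⊗[K] X.carrier →ₗ[K] N ⊗[K] (D ⊗[K] X.carrier) :=
  (TensorProduct.assoc K N D X.carrier).toLinearMap ∘ₗ N.coact.rTensor X.carrier -
    X.lcoact.lTensor N

theorem cotensorMap_coact (N : RightComod K D) (X : Bicomod K D C) (t : N ⊗[K] X.carrier) :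
    ((TensorProduct.assoc K N (D ⊗[K] X.carrier) C).symm.toLinearMap ∘ₗ
      ((TensorProduct.assoc K D X.carrier C).symm.toLinearMap ∘ₗ X.coact.lTensor D).lTensor N)
        (cotensorMap N X t) =
    (cotensorMap N X).rTensor C
      (((TensorProduct.assoc K N X.carrier C).symm.toLinearMap ∘ₗ X.coact.lTensor N) t) := by
  induction t with
  | zero => simp
  | add a b ha hb => simp only [map_add, ha, hb]
  | tmul n x =>
    have e : ∀ s : X.carrier ⊗[K] C,
        (cotensorMap N X).rTensor C ((TensorProduct.assoc K N X.carrier C).symm (n ⊗ₜ s)) =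
        ((TensorProduct.assoc K N D X.carrier).toLinearMap ∘ₗ N.coact.rTensor X.carrier).rTensor C
          ((TensorProduct.assoc K N X.carrier C).symm (n ⊗ₜ s)) -
        (TensorProduct.assoc K N (D ⊗[K] X.carrier) C).symm (n ⊗ₜ X.lcoact.rTensor C s) := by
      intro s
      induction s with
      | zero => simp
      | add a b ha hb =>
        simp only [map_add, TensorProduct.tmul_add, ha, hb]
        abel
      | tmul y c => simp [cotensorMap]
    have e2 : X.lcoact.rTensor C (X.coact x) =
        (TensorProduct.assoc K D X.carrier C).symm (X.coact.lTensor D (X.lcoact x)) := by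
      rw [← X.compat, LinearEquiv.symm_apply_apply]
    have e3 : ∀ s : N ⊗[K] D,
        ((TensorProduct.assoc K N (D ⊗[K] X.carrier) C).symm.toLinearMap ∘ₗ
          ((TensorProduct.assoc K D X.carrier C).symm.toLinearMap ∘ₗ
            X.coact.lTensor D).lTensor N) (TensorProduct.assoc K N D X.carrier (s ⊗ₜ x)) =
        (TensorProduct.assoc K N D X.carrier).toLinearMap.rTensor C
          ((TensorProduct.assoc K (N ⊗[K] D) X.carrier C).symm (s ⊗ₜ X.coact x)) := by
      intro s
      induction s with
      | zero => simp
      | add a b ha hb => simp only [map_add, TensorProduct.add_tmul, ha, hb]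
      | tmul n d =>
        simp only [TensorProduct.assoc_tmul, LinearMap.comp_apply, LinearMap.lTensor_tmul,
          LinearEquiv.coe_coe]
        generalize X.coact x = s
        induction s with
        | zero => simp
        | add a b ha hb => simp only [map_add, TensorProduct.tmul_add, ha, hb]
        | tmul y c => simp
    have e4 : ∀ s : X.carrier ⊗[K] C,
        ((TensorProduct.assoc K N D X.carrier).toLinearMap ∘ₗ N.coact.rTensor X.carrier).rTensor C
          ((TensorProduct.assoc K N X.carrier C).symm (n ⊗ₜ s)) =
        (TensorProduct.assoc K N D X.carrier).toLinearMap.rTensor C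
          ((TensorProduct.assoc K (N ⊗[K] D) X.carrier C).symm (N.coact n ⊗ₜ s)) := by
      intro s
      induction s with
      | zero => simp
      | add a b ha hb => simp only [map_add, TensorProduct.tmul_add, ha, hb]
      | tmul y c => simp
    have e5 : ((TensorProduct.assoc K N X.carrier C).symm.toLinearMap ∘ₗ X.coact.lTensor N)
        (n ⊗ₜ x) = (TensorProduct.assoc K N X.carrier C).symm (n ⊗ₜ X.coact x) := by simp
    have e6 : cotensorMap N X (n ⊗ₜ x) =
        TensorProduct.assoc K N D X.carrier (N.coact n ⊗ₜ x) - n ⊗ₜ X.lcoact x := by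
      simp [cotensorMap]
    rw [e5, e, e2, e4, ← e3, e6, map_sub]
    simp

theorem isSubcomodule_cotensor (N : RightComod K D) (X : Bicomod K D C) :
    (tensorComod N X.toRightComod).IsSubcomodule (LinearMap.ker (cotensorMap N X)) :=
  RightComod.isSubcomodule_ker (tensorComod N X.toRightComod) (cotensorMap N X) _
    (cotensorMap_coact N X)

/-- The cotensor product `N □_D X`, a right `C`-comodule with coaction induced by that of `X`. -/
def cotensor (N : RightComod K D) (X : Bicomod K D C) : RightComod K C :=
  (tensorComod N X.toRightComod).sub (LinearMap.ker (cotensorMap N X))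
    (isSubcomodule_cotensor N X)

theorem cotensorMap_naturality {N N' : RightComod K D} (f : N ⟶ N') (X : Bicomod K D C)
    (t : N ⊗[K] X.carrier) :
    cotensorMap N' X ((RightComod.lin f).rTensor X.carrier t) =
      (RightComod.lin f).rTensor (D ⊗[K] X.carrier) (cotensorMap N X t) := by
  induction t with
  | zero => simp
  | add a b ha hb => simp only [map_add, ha, hb]
  | tmul n x =>
    have : ∀ s : N ⊗[K] D, TensorProduct.assoc K N' D X.carrier
        (((RightComod.lin f).rTensor D s) ⊗ₜ x) =
        (RightComod.lin f).rTensor (D ⊗[K] X.carrier)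
          (TensorProduct.assoc K N D X.carrier (s ⊗ₜ x)) := by
      intro s
      induction s with
      | zero => simp
      | add a b ha hb => simp only [map_add, TensorProduct.add_tmul, ha, hb]
      | tmul n d => simp
    simp [cotensorMap, RightComod.lin_coact, this]

/-- The comodule morphism `f ⊗ X : N ⊗ X → N' ⊗ X`. -/
def tensorComodMap {N N' : RightComod K D} (f : N ⟶ N') (X : RightComod K C) :
    tensorComod N X ⟶ tensorComod N' X :=
  RightComod.ofLin (M := tensorComod N X) (N := tensorComod N' X)
    ((RightComod.lin f).rTensor X) fun t => by
  change ((TensorProduct.assoc K N' X C).symm.toLinearMap ∘ₗ X.coact.lTensor N')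
      ((RightComod.lin f).rTensor X t) = ((RightComod.lin f).rTensor X).rTensor C
    (((TensorProduct.assoc K N X C).symm.toLinearMap ∘ₗ X.coact.lTensor N) t)
  induction t using TensorProduct.induction_on with
  | zero => simp
  | add a b ha hb => simp only [map_add, ha, hb]
  | tmul n x =>
    simp only [LinearMap.comp_apply, LinearMap.lTensor_tmul, LinearMap.rTensor_tmul,
      LinearEquiv.coe_coe]
    generalize X.coact x = s
    induction s with
    | zero => simp
    | add a b ha hb => simp only [map_add, TensorProduct.tmul_add, ha, hb]
    | tmul y c => simp

/-- The functor `- □_D X` from right `D`-comodules to right `C`-comodules. -/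
def cotensorFunctor (X : Bicomod K D C) : RightComod K D ⥤ RightComod K C where
  obj N := cotensor N X
  map {N N'} f := RightComod.subMap (tensorComodMap f X.toRightComod)
    (isSubcomodule_cotensor N X) (isSubcomodule_cotensor N' X) fun t ht =>
      (cotensorMap_naturality f X t).trans <|
        (congrArg _ (LinearMap.mem_ker.1 ht)).trans (map_zero _)
  map_id N := by
    apply RightComod.hom_ext
    refine LinearMap.ext fun t => Subtype.ext ?_
    exact congrFun (congrArg DFunLike.coe (LinearMap.rTensor_id X.carrier N)) t.1
  map_comp f g := by
    apply RightComod.hom_ext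
    refine LinearMap.ext fun t => Subtype.ext ?_
    exact congrFun (congrArg DFunLike.coe
      (LinearMap.rTensor_comp X.carrier (RightComod.lin g) (RightComod.lin f))) t.1

end Cotensor

/-! ### The localized coalgebra `eCe`, the quotient functor and the section functor -/

section Localization

variable (K : Type u) (C : Type v) [Field K] [AddCommGroup C] [Module K C] [Coalgebra K C]

/-- Idempotent elements of the convolution algebra `C^*`. -/
abbrev DualIdempotent : Type (max u v) := {e : WithConv (C →ₗ[K] K) // IsIdempotentElem e}

variable {K C}

/-- The action `m ↦ e m = ∑ m₀ e(m₁)` of `e` on a right comodule. -/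
def act (e : DualIdempotent K C) (M : RightComod K C) : M →ₗ[K] M :=
  (TensorProduct.rid K M).toLinearMap ∘ₗ e.1.ofConv.lTensor M ∘ₗ M.coact

/-- The left action `c ↦ e c = ∑ c₁ e(c₂)` on `C`. -/
def lAct (e : DualIdempotent K C) : C →ₗ[K] C :=
  (TensorProduct.rid K C).toLinearMap ∘ₗ e.1.ofConv.lTensor C ∘ₗ CoalgebraStruct.comul

/-- The right action `c ↦ c e = ∑ e(c₁) c₂` on `C`. -/
def rAct (e : DualIdempotent K C) : C →ₗ[K] C :=
  (TensorProduct.lid K C).toLinearMap ∘ₗ e.1.ofConv.rTensor C ∘ₗ CoalgebraStruct.comul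

/-- The subspace `eCe` of `C`. -/
def corner (e : DualIdempotent K C) : Submodule K C := LinearMap.range (lAct e ∘ₗ rAct e)

/-- The subspace `Ce` of `C`. -/
def rightPart (e : DualIdempotent K C) : Submodule K C := LinearMap.range (rAct e)

/-- The projection `C → eCe`, `c ↦ e c e`. -/
def cornerProj (e : DualIdempotent K C) : C →ₗ[K] corner e :=
  (lAct e ∘ₗ rAct e).rangeRestrict

/-- The projection `C → Ce`, `c ↦ c e`. -/
def rightProj (e : DualIdempotent K C) : C →ₗ[K] rightPart e := (rAct e).rangeRestrict

/-- The subspace `eM` of a right comodule `M`. -/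
def actRange (e : DualIdempotent K C) (M : RightComod K C) : Submodule K M :=
  LinearMap.range (act e M)

/-- The projection `M → eM`, `m ↦ e m`. -/
def actProj (e : DualIdempotent K C) (M : RightComod K C) : M →ₗ[K] actRange e M :=
  (act e M).rangeRestrict

/-! #### Compatibility of the idempotent with the (co)actions -/

/-- `C` as a right comodule over itself. -/
def regular (K : Type u) (C : Type v) [Field K] [AddCommGroup C] [Module K C] [Coalgebra K C] :
    RightComod K C where
  carrier := C
  coact := CoalgebraStruct.comul
  coassoc := Coalgebra.coassoc_apply
  counit := Coalgebra.lTensor_counit_comul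

variable (e : DualIdempotent K C)

theorem e_lAct (c : C) : e.1.ofConv (lAct e c) = e.1.ofConv c := by
  have h := congrArg (fun f => f.ofConv c) e.2
  simp only [LinearMap.convMul_def, WithConv.ofConv_toConv, LinearMap.comp_apply] at h
  rw [← h]
  simp only [lAct, LinearMap.comp_apply, LinearEquiv.coe_coe]
  generalize CoalgebraStruct.comul (R := K) c = s
  induction s with
  | zero => simp
  | add a b ha hb => simp only [map_add, ha, hb]
  | tmul x y => simp [mul_comm]

theorem e_rAct (c : C) : e.1.ofConv (rAct e c) = e.1.ofConv c := by
  have h := congrArg (fun f => f.ofConv c) e.2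
  simp only [LinearMap.convMul_def, WithConv.ofConv_toConv, LinearMap.comp_apply] at h
  rw [← h]
  simp only [rAct, LinearMap.comp_apply, LinearEquiv.coe_coe]
  generalize CoalgebraStruct.comul (R := K) c = s
  induction s with
  | zero => simp
  | add a b ha hb => simp only [map_add, ha, hb]
  | tmul x y => simp

theorem coact_act (M : RightComod K C) (m : M) :
    M.coact (act e M m) = (lAct e).lTensor M (M.coact m) := by
  have h : ∀ s : M ⊗[K] C, M.coact (TensorProduct.rid K M (e.1.ofConv.lTensor M s)) =
      ((TensorProduct.rid K C).toLinearMap ∘ₗ e.1.ofConv.lTensor C).lTensor M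
        (TensorProduct.assoc K M C C (M.coact.rTensor C s)) := by
    intro s
    induction s with
    | zero => simp
    | add a b ha hb => simp only [map_add, ha, hb]
    | tmul x c =>
      simp only [LinearMap.lTensor_tmul, LinearMap.rTensor_tmul, TensorProduct.rid_tmul, map_smul]
      generalize M.coact x = s
      induction s with
      | zero => simp
      | add a b ha hb => simp only [map_add, TensorProduct.add_tmul, smul_add, ha, hb]
      | tmul y d => simp
  refine (h _).trans ?_
  rw [M.coassoc, ← LinearMap.comp_apply, ← LinearMap.lTensor_comp]
  rfl

theorem act_act (M : RightComod K C) (m : M) : act e M (act e M m) = act e M m := by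
  have h := coact_act e M m
  change TensorProduct.rid K M (e.1.ofConv.lTensor M (M.coact (act e M m))) =
    TensorProduct.rid K M (e.1.ofConv.lTensor M (M.coact m))
  rw [h, ← LinearMap.comp_apply, ← LinearMap.lTensor_comp,
    show e.1.ofConv ∘ₗ lAct e = e.1.ofConv from LinearMap.ext (e_lAct e)]

theorem comul_lAct (c : C) : CoalgebraStruct.comul (R := K) (lAct e c) =
    (lAct e).lTensor C (CoalgebraStruct.comul (R := K) c) := coact_act e (regular K C) c

theorem lAct_lAct (c : C) : lAct e (lAct e c) = lAct e c := act_act e (regular K C) c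

theorem comul_rAct (c : C) : CoalgebraStruct.comul (R := K) (rAct e c) =
    (rAct e).rTensor C (CoalgebraStruct.comul (R := K) c) := by
  have h : ∀ s : C ⊗[K] C, CoalgebraStruct.comul (R := K)
      (TensorProduct.lid K C (e.1.ofConv.rTensor C s)) =
      ((TensorProduct.lid K C).toLinearMap ∘ₗ e.1.ofConv.rTensor C).rTensor C
        ((TensorProduct.assoc K C C C).symm
          ((CoalgebraStruct.comul (R := K) (A := C)).lTensor C s)) := by
    intro s
    induction s with
    | zero => simp
    | add a b ha hb => simp only [map_add, ha, hb]
    | tmul x c =>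
      simp only [LinearMap.lTensor_tmul, LinearMap.rTensor_tmul, TensorProduct.lid_tmul, map_smul]
      generalize CoalgebraStruct.comul (R := K) c = s
      induction s with
      | zero => simp
      | add a b ha hb => simp only [map_add, TensorProduct.tmul_add, smul_add, ha, hb]
      | tmul y d => simp [TensorProduct.smul_tmul']
  refine (h _).trans ?_
  rw [Coalgebra.coassoc_symm_apply, ← LinearMap.comp_apply, ← LinearMap.rTensor_comp]
  rfl

theorem rAct_rAct (c : C) : rAct e (rAct e c) = rAct e c := by
  have h := comul_rAct e c
  change TensorProduct.lid K C (e.1.ofConv.rTensor C (CoalgebraStruct.comul (rAct e c))) =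
    TensorProduct.lid K C (e.1.ofConv.rTensor C (CoalgebraStruct.comul c))
  rw [h, ← LinearMap.comp_apply, ← LinearMap.rTensor_comp,
    show e.1.ofConv ∘ₗ rAct e = e.1.ofConv from LinearMap.ext (e_rAct e)]

theorem lAct_rAct (c : C) : lAct e (rAct e c) = rAct e (lAct e c) := by
  have h := comul_rAct e c
  change TensorProduct.rid K C (e.1.ofConv.lTensor C (CoalgebraStruct.comul (rAct e c))) =
    rAct e (TensorProduct.rid K C (e.1.ofConv.lTensor C (CoalgebraStruct.comul c)))
  rw [h]
  generalize CoalgebraStruct.comul (R := K) c = s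
  induction s with
  | zero => simp
  | add a b ha hb => simp only [map_add, ha, hb]
  | tmul x y => simp

theorem counit_lAct (c : C) : CoalgebraStruct.counit (R := K) (lAct e c) = e.1.ofConv c := by
  have h : ∀ s : C ⊗[K] C, CoalgebraStruct.counit (R := K)
      (TensorProduct.rid K C (e.1.ofConv.lTensor C s)) =
      e.1.ofConv (TensorProduct.lid K C
        ((CoalgebraStruct.counit (R := K) (A := C)).rTensor C s)) := by
    intro s
    induction s with
    | zero => simp
    | add a b ha hb => simp only [map_add, ha, hb]
    | tmul x y => simp [mul_comm]
  refine (h _).trans ?_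
  rw [Coalgebra.rTensor_counit_comul]
  simp

theorem cornerProj_rAct (c : C) : cornerProj e (rAct e c) = cornerProj e c :=
  Subtype.ext (congrArg (lAct e) (rAct_rAct e c))

theorem cornerProj_lAct (c : C) : cornerProj e (lAct e c) = cornerProj e c :=
  Subtype.ext (by
    change lAct e (rAct e (lAct e c)) = lAct e (rAct e c)
    rw [← lAct_rAct, lAct_lAct])

theorem rightProj_rAct (c : C) : rightProj e (rAct e c) = rightProj e c :=
  Subtype.ext (rAct_rAct e c)

theorem actProj_act (M : RightComod K C) (m : M) : actProj e M (act e M m) = actProj e M m :=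
  Subtype.ext (act_act e M m)

theorem cornerProj_surjective : Function.Surjective (cornerProj e) :=
  LinearMap.surjective_rangeRestrict _

theorem rightProj_surjective : Function.Surjective (rightProj e) :=
  LinearMap.surjective_rangeRestrict _

theorem actProj_surjective (M : RightComod K C) : Function.Surjective (actProj e M) :=
  LinearMap.surjective_rangeRestrict _

/-! #### The coalgebra `eCe` -/

/-- The comultiplication `exe ↦ ∑ e x₁ e ⊗ e x₂ e` and the counit of `C` restricted to `eCe`. -/
instance : CoalgebraStruct K (corner e) where
  comul := TensorProduct.map (cornerProj e) (cornerProj e) ∘ₗ CoalgebraStruct.comul ∘ₗ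
    (corner e).subtype
  counit := CoalgebraStruct.counit ∘ₗ (corner e).subtype

theorem comul_cornerProj (c : C) : CoalgebraStruct.comul (R := K) (cornerProj e c) =
    TensorProduct.map (cornerProj e) (cornerProj e) (CoalgebraStruct.comul c) := by
  change TensorProduct.map (cornerProj e) (cornerProj e)
    (CoalgebraStruct.comul (lAct e (rAct e c))) = _
  rw [comul_lAct, comul_rAct]
  generalize CoalgebraStruct.comul (R := K) c = s
  induction s with
  | zero => simp
  | add a b ha hb => simp only [map_add, ha, hb]
  | tmul x y => simp [cornerProj_lAct, cornerProj_rAct]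

theorem counit_cornerProj (c : C) :
    CoalgebraStruct.counit (R := K) (cornerProj e c) = e.1.ofConv c :=
  (counit_lAct e _).trans (e_rAct e c)

theorem corner_coassoc (c : C) :
    TensorProduct.assoc K (corner e) (corner e) (corner e)
      ((CoalgebraStruct.comul (R := K) (A := corner e)).rTensor (corner e)
        (CoalgebraStruct.comul (R := K) (cornerProj e c))) =
      (CoalgebraStruct.comul (R := K) (A := corner e)).lTensor (corner e)
        (CoalgebraStruct.comul (R := K) (cornerProj e c)) := by
  rw [comul_cornerProj, assoc_rTensor_map (comul_cornerProj e), lTensor_map (comul_cornerProj e),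
    Coalgebra.coassoc_apply]

/-- The coalgebra `eCe`. -/
instance : Coalgebra K (corner e) where
  coassoc := by
    refine LinearMap.ext fun x => ?_
    obtain ⟨c, rfl⟩ := cornerProj_surjective e x
    exact corner_coassoc e c
  rTensor_counit_comp_comul := by
    refine LinearMap.ext fun x => ?_
    obtain ⟨c, rfl⟩ := cornerProj_surjective e x
    have h : ∀ s : C ⊗[K] C, (CoalgebraStruct.counit (R := K) (A := corner e)).rTensor (corner e)
        (TensorProduct.map (cornerProj e) (cornerProj e) s) =
        1 ⊗ₜ[K] cornerProj e (TensorProduct.lid K C (e.1.ofConv.rTensor C s)) := by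
      intro s
      induction s with
      | zero => simp
      | add a b ha hb => simp only [map_add, TensorProduct.tmul_add, ha, hb]
      | tmul x y => simp [counit_cornerProj, TensorProduct.smul_tmul']
    rw [LinearMap.comp_apply, comul_cornerProj, h]
    exact congrArg _ (cornerProj_rAct e c)
  lTensor_counit_comp_comul := by
    refine LinearMap.ext fun x => ?_
    obtain ⟨c, rfl⟩ := cornerProj_surjective e x
    have h : ∀ s : C ⊗[K] C, (CoalgebraStruct.counit (R := K) (A := corner e)).lTensor (corner e)
        (TensorProduct.map (cornerProj e) (cornerProj e) s) =
        cornerProj e (TensorProduct.rid K C (e.1.ofConv.lTensor C s)) ⊗ₜ[K] 1 := by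
      intro s
      induction s with
      | zero => simp
      | add a b ha hb => simp only [map_add, TensorProduct.add_tmul, ha, hb]
      | tmul x y => simp [counit_cornerProj, TensorProduct.smul_tmul]
    rw [LinearMap.comp_apply, comul_cornerProj, h]
    exact congrArg (fun z => z ⊗ₜ[K] (1 : K)) (cornerProj_lAct e c)

/-! #### The quotient functor `T = e(-)` -/

/-- The right `eCe`-coaction `em ↦ ∑ e m₀ ⊗ e m₁ e` on `eM`. -/
def quotCoact (M : RightComod K C) : actRange e M →ₗ[K] actRange e M ⊗[K] corner e :=
  TensorProduct.map (actProj e M) (cornerProj e) ∘ₗ M.coact ∘ₗ (actRange e M).subtype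

theorem quotCoact_actProj (M : RightComod K C) (m : M) : quotCoact e M (actProj e M m) =
    TensorProduct.map (actProj e M) (cornerProj e) (M.coact m) := by
  change TensorProduct.map (actProj e M) (cornerProj e) (M.coact (act e M m)) = _
  rw [coact_act]
  generalize M.coact m = s
  induction s with
  | zero => simp
  | add a b ha hb => simp only [map_add, ha, hb]
  | tmul x y => simp [cornerProj_lAct]

/-- The right `eCe`-comodule `T(M) = eM`. -/
def quotObj (M : RightComod K C) : RightComod K (corner e) where
  carrier := actRange e M
  coact := quotCoact e M
  coassoc x := by
    obtain ⟨m, rfl⟩ := actProj_surjective e M x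
    rw [quotCoact_actProj, assoc_rTensor_map (quotCoact_actProj e M),
      lTensor_map (comul_cornerProj e), M.coassoc]
  counit x := by
    obtain ⟨m, rfl⟩ := actProj_surjective e M x
    have h : ∀ s : M ⊗[K] C,
        (CoalgebraStruct.counit (R := K) (A := corner e)).lTensor (actRange e M)
        (TensorProduct.map (actProj e M) (cornerProj e) s) =
        actProj e M (TensorProduct.rid K M (e.1.ofConv.lTensor M s)) ⊗ₜ[K] 1 := by
      intro s
      induction s with
      | zero => simp
      | add a b ha hb => simp only [map_add, TensorProduct.add_tmul, ha, hb]
      | tmul x y => simp [counit_cornerProj, TensorProduct.smul_tmul]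
    rw [quotCoact_actProj, h]
    exact congrArg (fun z => z ⊗ₜ[K] (1 : K)) (actProj_act e M m)

theorem lin_act {M N : RightComod K C} (f : M ⟶ N) (m : M) :
    RightComod.lin f (act e M m) = act e N (RightComod.lin f m) := by
  change _ = TensorProduct.rid K N (e.1.ofConv.lTensor N (N.coact (RightComod.lin f m)))
  rw [RightComod.lin_coact]
  change RightComod.lin f (TensorProduct.rid K M (e.1.ofConv.lTensor M (M.coact m))) = _
  generalize M.coact m = s
  induction s with
  | zero => simp
  | add a b ha hb => simp only [map_add, ha, hb]
  | tmul x y => simp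

theorem lin_mem_actRange {M N : RightComod K C} (f : M ⟶ N) (x : M) (hx : x ∈ actRange e M) :
    RightComod.lin f x ∈ actRange e N := by
  obtain ⟨m, rfl⟩ := hx
  exact ⟨RightComod.lin f m, (lin_act e f m).symm⟩

/-- The restriction `eM → eN` of a comodule morphism `M → N`. -/
def quotMap {M N : RightComod K C} (f : M ⟶ N) : quotObj e M ⟶ quotObj e N :=
  RightComod.ofLin (M := quotObj e M) (N := quotObj e N)
    ((RightComod.lin f).restrict (lin_mem_actRange e f)) fun x => by
  obtain ⟨m, rfl⟩ := actProj_surjective e M x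
  have h1 : ∀ m : M, (RightComod.lin f).restrict (lin_mem_actRange e f) (actProj e M m) =
      actProj e N (RightComod.lin f m) := fun m => Subtype.ext (lin_act e f m)
  change quotCoact e N ((RightComod.lin f).restrict (lin_mem_actRange e f) (actProj e M m)) =
    ((RightComod.lin f).restrict (lin_mem_actRange e f)).rTensor (corner e)
      (quotCoact e M (actProj e M m))
  rw [h1, quotCoact_actProj, quotCoact_actProj, RightComod.lin_coact]
  generalize M.coact m = s
  induction s with
  | zero => simp
  | add a b ha hb => simp only [map_add, ha, hb]
  | tmul x y => simp [h1]

/-- The quotient functor `T = e(-)` from right `C`-comodules to right `eCe`-comodules. -/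
def quotientFunctor : RightComod K C ⥤ RightComod K (corner e) where
  obj M := quotObj e M
  map f := quotMap e f
  map_id _ := rfl
  map_comp _ _ := rfl

/-- A right `C`-comodule `M` is torsion if `T(M) = 0`. -/
def IsTorsion (M : RightComod K C) : Prop := Subsingleton ((quotientFunctor e).obj M)

/-- A right `C`-comodule is torsion-free if its only torsion subcomodule is zero. -/
def IsTorsionFree (M : RightComod K C) : Prop :=
  ∀ (W : Submodule K M) (h : M.IsSubcomodule W), IsTorsion e (M.sub W h) → W = ⊥

/-! #### The section functor `S = - □_{eCe} Ce` -/

/-- The left `eCe`-coaction `xe ↦ ∑ e x₁ e ⊗ x₂ e` on `Ce`. -/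
def rightPartLCoact : rightPart e →ₗ[K] corner e ⊗[K] rightPart e :=
  TensorProduct.map (cornerProj e) (rightProj e) ∘ₗ CoalgebraStruct.comul ∘ₗ (rightPart e).subtype

/-- The right `C`-coaction `xe ↦ ∑ x₁ e ⊗ x₂` on `Ce`, the restriction of the comultiplication
of `C`. -/
def rightPartCoact : rightPart e →ₗ[K] rightPart e ⊗[K] C :=
  TensorProduct.map (rightProj e) LinearMap.id ∘ₗ CoalgebraStruct.comul ∘ₗ (rightPart e).subtype

theorem rightPartLCoact_rightProj (c : C) : rightPartLCoact e (rightProj e c) =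
    TensorProduct.map (cornerProj e) (rightProj e) (CoalgebraStruct.comul c) := by
  change TensorProduct.map (cornerProj e) (rightProj e) (CoalgebraStruct.comul (rAct e c)) = _
  rw [comul_rAct]
  generalize CoalgebraStruct.comul (R := K) c = s
  induction s with
  | zero => simp
  | add a b ha hb => simp only [map_add, ha, hb]
  | tmul x y => simp [cornerProj_rAct]

theorem rightPartCoact_rightProj (c : C) : rightPartCoact e (rightProj e c) =
    TensorProduct.map (rightProj e) LinearMap.id (CoalgebraStruct.comul c) := by
  change TensorProduct.map (rightProj e) LinearMap.id (CoalgebraStruct.comul (rAct e c)) = _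
  rw [comul_rAct]
  generalize CoalgebraStruct.comul (R := K) c = s
  induction s with
  | zero => simp
  | add a b ha hb => simp only [map_add, ha, hb]
  | tmul x y => simp [rightProj_rAct]

/-- The `(eCe, C)`-bicomodule `Ce`. -/
def rightBicomod : Bicomod K (corner e) C where
  carrier := rightPart e
  coact := rightPartCoact e
  coassoc x := by
    obtain ⟨c, rfl⟩ := rightProj_surjective e x
    rw [rightPartCoact_rightProj, assoc_rTensor_map (rightPartCoact_rightProj e),
      lTensor_map (γ := CoalgebraStruct.comul) (w := LinearMap.id) (z := LinearMap.id)
        (fun b => by simp), Coalgebra.coassoc_apply]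
  counit x := by
    obtain ⟨c, rfl⟩ := rightProj_surjective e x
    rw [rightPartCoact_rightProj, ← LinearMap.rTensor_def, ← LinearMap.comp_apply,
      LinearMap.lTensor_comp_rTensor, ← LinearMap.rTensor_comp_lTensor, LinearMap.comp_apply,
      Coalgebra.lTensor_counit_comul, LinearMap.rTensor_tmul]
  lcoact := rightPartLCoact e
  lcoassoc x := by
    obtain ⟨c, rfl⟩ := rightProj_surjective e x
    rw [rightPartLCoact_rightProj, assoc_rTensor_map (comul_cornerProj e),
      lTensor_map (rightPartLCoact_rightProj e), Coalgebra.coassoc_apply]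
  lcounit x := by
    obtain ⟨c, rfl⟩ := rightProj_surjective e x
    have h : ∀ s : C ⊗[K] C,
        (CoalgebraStruct.counit (R := K) (A := corner e)).rTensor (rightPart e)
        (TensorProduct.map (cornerProj e) (rightProj e) s) =
        1 ⊗ₜ[K] rightProj e (TensorProduct.lid K C (e.1.ofConv.rTensor C s)) := by
      intro s
      induction s with
      | zero => simp
      | add a b ha hb => simp only [map_add, TensorProduct.tmul_add, ha, hb]
      | tmul x y => simp [counit_cornerProj, TensorProduct.smul_tmul']
    rw [rightPartLCoact_rightProj, h]
    exact congrArg _ (rightProj_rAct e c)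
  compat x := by
    obtain ⟨c, rfl⟩ := rightProj_surjective e x
    rw [rightPartCoact_rightProj, assoc_rTensor_map (rightPartLCoact_rightProj e),
      rightPartLCoact_rightProj, lTensor_map (rightPartCoact_rightProj e),
      Coalgebra.coassoc_apply]

/-- The section functor `S = - □_{eCe} Ce` from right `eCe`-comodules to right `C`-comodules. -/
def sectionFunctor : RightComod K (corner e) ⥤ RightComod K C := cotensorFunctor (rightBicomod e)

/-- The restriction of the section functor to quasi-finite comodules, available once it is known
that it sends quasi-finite comodules to quasi-finite comodules. -/
def sectionFunctorQF (h : ∀ N : RightComod K (corner e), N.IsQuasiFinite →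
      ((sectionFunctor e).obj N).IsQuasiFinite) :
    (RightComod.IsQuasiFinite (K := K) (C := corner e)).FullSubcategory ⥤
      (RightComod.IsQuasiFinite (K := K) (C := C)).FullSubcategory :=
  ObjectProperty.lift _ (ObjectProperty.ι _ ⋙ sectionFunctor e) (fun N => h N.obj N.property)

end Localization

end ComodLoc

end

open ComodLoc

/-! Everything follows from one fact: `S` is right adjoint to `T`, and the counit `T(S(N)) → N` is
an isomorphism. The unit is `m ↦ ∑ e m₀ ⊗ m₁ e`, and the counit is `1 ⊗ ε` restricted to `e(N □
Ce)`.

For bijectivity of the counit, let `t ∈ N □ Ce` and apply `1 ⊗ 1 ⊗ ε` to the equation that defines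
the cotensor product. The result says that `ρ_N((1 ⊗ ε) t)` is the image of `t` in `N ⊗ eCe`
(`coact_contract`). Since `e` acts on `N ⊗ Ce` through the projection `Ce → eCe` (`act_tensor`), the
element `e t` is determined by `(1 ⊗ ε) t`, which gives injectivity. For surjectivity, `ρ_N(n)`,
viewed in `N ⊗ Ce`, lies in the cotensor product by coassociativity and is sent to `n` by the counit
axiom.

Consequently `S` is full and faithful. It therefore reflects isomorphism classes, and it preserves
indecomposability, because every idempotent endomorphism of `S(N)` comes from one of `N`. As `T`
preserves monomorphisms, its right adjoint `S` preserves injectives. The bijection `Hom(M, S(N)) ≅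
Hom(T(M), N)` makes `S(N)` torsion-free, and its linearity makes `S(N)` quasi-finite when `N` is.

For simple `Y`, a nonzero subcomodule `W` of `S(Y)` has a nonzero, hence surjective, transpose `T(W)
→ Y`. So `W` contains all of `e S(Y) ≠ 0`, two nonzero subcomodules always meet, and `S(Y)` has a
unique simple subcomodule. If `Y ≅ T(S_x)`, that subcomodule is the image of `S_x` under the
transposed isomorphism. The same transposition turns an envelope `T(S_x) → E'` into an envelope `S_x
→ S(E')`, and uniqueness of envelopes identifies `S(E')` with `E_x`.

Subcomodules and colinearity are tested through the action of `C^*`: a tensor in `M ⊗ C` is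
determined by its contractions with functionals on `C`. -/

noncomputable section

namespace ComodLoc

/-! ### Tensors and linear functionals -/

section TensorFunctional

variable {K : Type*} [Field K] {M N C : Type*} [AddCommGroup M] [Module K M]
  [AddCommGroup N] [Module K N] [AddCommGroup C] [Module K C]

/-- The contraction `1 ⊗ f : M ⊗ C → M` with a linear functional `f` on `C`. -/
def contract (M : Type*) [AddCommGroup M] [Module K M] (f : C →ₗ[K] K) : M ⊗[K] C →ₗ[K] M :=
  (TensorProduct.rid K M).toLinearMap ∘ₗ f.lTensor M

@[simp] theorem contract_tmul (f : C →ₗ[K] K) (m : M) (c : C) :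
    contract M f (m ⊗ₜ c) = f c • m := by
  simp [contract]

theorem contract_rTensor (f : C →ₗ[K] K) (g : M →ₗ[K] N) (t : M ⊗[K] C) :
    contract N f (g.rTensor C t) = g (contract M f t) := by
  induction t with
  | zero => simp
  | add a b ha hb => simp only [map_add, ha, hb]
  | tmul x y => simp

/-- The coordinates of a tensor with respect to a basis of `C` are its contractions with the
coordinate functionals. -/
theorem eq_zero_of_contract_eq_zero {t : M ⊗[K] C} (h : ∀ f : C →ₗ[K] K, contract M f t = 0) :
    t = 0 := by
  classical
  let b := Module.Basis.ofVectorSpace K C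
  apply (TensorProduct.equivFinsuppOfBasisRight (M := M) b).injective
  ext i
  have key : ∀ s : M ⊗[K] C,
      TensorProduct.equivFinsuppOfBasisRight (M := M) b s i = contract M (b.coord i) s := by
    intro s
    induction s with
    | zero => simp
    | add x y hx hy => simp only [map_add, Finsupp.add_apply, hx, hy]
    | tmul x y => simp
  rw [key, h, map_zero, Finsupp.zero_apply]

theorem eq_of_contract_eq {s t : M ⊗[K] C}
    (h : ∀ f : C →ₗ[K] K, contract M f s = contract M f t) : s = t :=
  sub_eq_zero.1 (eq_zero_of_contract_eq_zero fun f => by rw [map_sub, h, sub_self])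

/-- `W ⊗ C` is the kernel of `M ⊗ C → (M/W) ⊗ C`, and vanishing in the target can be tested on
functionals. -/
theorem mem_range_rTensor_iff (W : Submodule K M) (t : M ⊗[K] C) :
    t ∈ LinearMap.range (W.subtype.rTensor C) ↔ ∀ f : C →ₗ[K] K, contract M f t ∈ W := by
  constructor
  · rintro ⟨s, rfl⟩ f
    rw [contract_rTensor]
    exact (contract W f s).2
  · intro h
    have ex : Function.Exact (W.subtype.rTensor C) (W.mkQ.rTensor C) :=
      rTensor_exact C (LinearMap.exact_subtype_mkQ W) W.mkQ_surjective
    refine (ex t).1 (eq_zero_of_contract_eq_zero fun f => ?_)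
    rw [contract_rTensor]
    simpa using h f

theorem finite_span_contract (t : M ⊗[K] C) :
    ∃ W : Submodule K M, Module.Finite K W ∧ ∀ f : C →ₗ[K] K, contract M f t ∈ W := by
  induction t with
  | zero => exact ⟨⊥, inferInstance, by simp⟩
  | add a b ha hb =>
    obtain ⟨W, hW, ha⟩ := ha
    obtain ⟨W', hW', hb⟩ := hb
    refine ⟨W ⊔ W', inferInstance, fun f => ?_⟩
    rw [map_add]
    exact Submodule.add_mem_sup (ha f) (hb f)
  | tmul m c =>
    refine ⟨Submodule.span K {m}, inferInstance, fun f => ?_⟩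
    rw [contract_tmul]
    exact Submodule.smul_mem _ _ (Submodule.mem_span_singleton_self m)

end TensorFunctional

namespace RightComod

variable {K : Type u} {C : Type v} [Field K] [AddCommGroup C] [Module K C] [Coalgebra K C]

/-! ### The action of the dual algebra -/

/-- The action `m ↦ ∑ m₀ f(m₁)` of a functional `f` on a right comodule. -/
def dualAct (M : RightComod K C) (f : C →ₗ[K] K) : M →ₗ[K] M := contract M f ∘ₗ M.coact

theorem lin_dualAct {M N : RightComod K C} (g : M ⟶ N) (f : C →ₗ[K] K) (m : M) :
    lin g (M.dualAct f m) = N.dualAct f (lin g m) := by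
  change lin g (contract M f (M.coact m)) = contract N f (N.coact (lin g m))
  rw [lin_coact, contract_rTensor]

/-- A linear map commuting with the action of the dual algebra is a comodule morphism. -/
def ofDualAct {M N : RightComod K C} (g : M →ₗ[K] N)
    (hg : ∀ f m, g (M.dualAct f m) = N.dualAct f (g m)) : M ⟶ N :=
  ofLin g fun m => eq_of_contract_eq fun f => by
    rw [contract_rTensor]
    exact (hg f m).symm

@[simp] theorem lin_ofDualAct {M N : RightComod K C} (g : M →ₗ[K] N)
    (hg : ∀ f m, g (M.dualAct f m) = N.dualAct f (g m)) : lin (ofDualAct g hg) = g := rfl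

/-- Subcomodules are exactly the `C^*`-submodules; closure properties of subcomodules become
elementary in this form. -/
theorem isSubcomodule_iff {M : RightComod K C} {W : Submodule K M} :
    M.IsSubcomodule W ↔ ∀ (f : C →ₗ[K] K), ∀ m ∈ W, M.dualAct f m ∈ W :=
  ⟨fun h f m hm => (mem_range_rTensor_iff W _).1 (h m hm) f,
    fun h m hm => (mem_range_rTensor_iff W _).2 fun f => h f m hm⟩

theorem dualAct_counit (M : RightComod K C) (m : M) :
    M.dualAct CoalgebraStruct.counit m = m := by
  change TensorProduct.rid K M (_) = m
  rw [M.counit]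
  simp

/-- The functional on the right is the convolution `f * g : c ↦ ∑ f(c₁) g(c₂)`, so coassociativity
makes `M` a left module over `C^*`. -/
theorem dualAct_dualAct (M : RightComod K C) (f g : C →ₗ[K] K) (m : M) :
    M.dualAct f (M.dualAct g m) =
      M.dualAct (f ∘ₗ contract C g ∘ₗ CoalgebraStruct.comul) m := by
  have h1 : ∀ t : M ⊗[K] C, M.dualAct f (contract M g t) =
      contract M (f ∘ₗ contract C g) (TensorProduct.assoc K M C C (M.coact.rTensor C t)) := by
    intro t
    induction t with
    | zero => simp
    | add a b ha hb => simp only [map_add, ha, hb]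
    | tmul x y =>
      rw [contract_tmul, map_smul, LinearMap.rTensor_tmul, dualAct, LinearMap.comp_apply]
      generalize M.coact x = s
      induction s with
      | zero => simp
      | add a b ha hb => simp only [map_add, TensorProduct.add_tmul, smul_add, ha, hb]
      | tmul a b => simp [smul_smul]
  have h2 : ∀ t : M ⊗[K] C, contract M (f ∘ₗ contract C g)
      ((CoalgebraStruct.comul (R := K) (A := C)).lTensor M t) =
      contract M (f ∘ₗ contract C g ∘ₗ CoalgebraStruct.comul) t := by
    intro t
    induction t with
    | zero => simp
    | add a b ha hb => simp only [map_add, ha, hb]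
    | tmul x y => simp
  exact (h1 _).trans ((congrArg _ (M.coassoc m)).trans (h2 _))

/-! ### Subcomodules and morphisms -/

/-- The inclusion of a subcomodule. -/
def subι (M : RightComod K C) (W : Submodule K M) (h : M.IsSubcomodule W) : M.sub W h ⟶ M :=
  ofLin (M := M.sub W h) W.subtype fun w => (M.restrictCoact_spec W h w).symm

@[simp] theorem subι_apply (M : RightComod K C) (W : Submodule K M) (h : M.IsSubcomodule W)
    (w : W) : lin (M.subι W h) w = (w : M) := rfl

theorem subι_injective (M : RightComod K C) (W : Submodule K M) (h : M.IsSubcomodule W) :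
    Function.Injective (lin (M.subι W h)) := Subtype.val_injective

theorem range_subι (M : RightComod K C) (W : Submodule K M) (h : M.IsSubcomodule W) :
    LinearMap.range (lin (M.subι W h)) = W := W.range_subtype

theorem IsSubcomodule.map {M N : RightComod K C} (g : M ⟶ N) {W : Submodule K M}
    (h : M.IsSubcomodule W) : N.IsSubcomodule (W.map (lin g)) := by
  rw [isSubcomodule_iff] at h ⊢
  rintro f _ ⟨m, hm, rfl⟩
  exact ⟨_, h f m hm, lin_dualAct g f m⟩

theorem IsSubcomodule.comap {M N : RightComod K C} (g : M ⟶ N) {W : Submodule K N}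
    (h : N.IsSubcomodule W) : M.IsSubcomodule (W.comap (lin g)) := by
  rw [isSubcomodule_iff] at h ⊢
  intro f m hm
  rw [Submodule.mem_comap, lin_dualAct]
  exact h f _ hm

theorem isSubcomodule_bot (M : RightComod K C) : M.IsSubcomodule ⊥ := by
  rw [isSubcomodule_iff]
  rintro f m rfl
  simp

theorem isSubcomodule_top (M : RightComod K C) : M.IsSubcomodule ⊤ :=
  isSubcomodule_iff.2 fun _ _ _ => trivial

theorem isSubcomodule_range {M N : RightComod K C} (g : M ⟶ N) :
    N.IsSubcomodule (LinearMap.range (lin g)) :=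
  LinearMap.range_eq_map (lin g) ▸ M.isSubcomodule_top.map g

theorem isSubcomodule_ker_lin {M N : RightComod K C} (g : M ⟶ N) :
    M.IsSubcomodule (LinearMap.ker (lin g)) := N.isSubcomodule_bot.comap g

theorem IsSubcomodule.inf {M : RightComod K C} {W W' : Submodule K M}
    (h : M.IsSubcomodule W) (h' : M.IsSubcomodule W') : M.IsSubcomodule (W ⊓ W') := by
  rw [isSubcomodule_iff] at h h' ⊢
  exact fun f m hm => ⟨h f m hm.1, h' f m hm.2⟩

theorem mono_of_injective {M N : RightComod K C} (g : M ⟶ N)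
    (h : Function.Injective (lin g)) : Mono g where
  right_cancellation _ _ hab := hom_ext <| LinearMap.ext fun x =>
    h (LinearMap.congr_fun (congrArg lin hab) x)

/-- The inclusion of the kernel and the zero map agree after composition with `g`, hence agree. -/
theorem injective_of_mono {M N : RightComod K C} (g : M ⟶ N) [Mono g] :
    Function.Injective (lin g) := by
  rw [← LinearMap.ker_eq_bot, eq_bot_iff]
  intro m hm
  have hk := isSubcomodule_ker_lin g
  have h : M.subι _ hk = ofLin (M := M.sub _ hk) (N := M) 0 (by simp) :=
    (cancel_mono g).1 <| hom_ext <| LinearMap.ext fun x =>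
      (LinearMap.mem_ker.1 x.2).trans (map_zero (lin g)).symm
  exact LinearMap.congr_fun (congrArg lin h) ⟨m, hm⟩

/-- A bijective comodule morphism is an isomorphism. -/
def isoOfBijective {M N : RightComod K C} (g : M ⟶ N) (h : Function.Bijective (lin g)) :
    M ≅ N where
  hom := g
  inv := ofDualAct (LinearEquiv.ofBijective (lin g) h).symm.toLinearMap fun f n => by
    apply h.1
    have key : ∀ n, lin g ((LinearEquiv.ofBijective (lin g) h).symm n) = n :=
      (LinearEquiv.ofBijective (lin g) h).apply_symm_apply
    rw [lin_dualAct]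
    exact (key _).trans (congrArg _ (key n).symm)
  hom_inv_id := hom_ext <| LinearMap.ext fun m =>
    (LinearEquiv.ofBijective (lin g) h).symm_apply_apply m
  inv_hom_id := hom_ext <| LinearMap.ext fun n =>
    (LinearEquiv.ofBijective (lin g) h).apply_symm_apply n

theorem inv_lin_hom_lin {M N : RightComod K C} (i : M ≅ N) (m : M) :
    lin i.inv (lin i.hom m) = m :=
  LinearMap.congr_fun (congrArg lin i.hom_inv_id) m

theorem hom_lin_inv_lin {M N : RightComod K C} (i : M ≅ N) (n : N) :
    lin i.hom (lin i.inv n) = n := inv_lin_hom_lin i.symm n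

/-- The underlying linear equivalence of an isomorphism of comodules. -/
def linIso {M N : RightComod K C} (i : M ≅ N) : M ≃ₗ[K] N :=
  LinearEquiv.ofLinearMap (lin i.hom) (lin i.inv) (congrArg lin i.inv_hom_id)
    (congrArg lin i.hom_inv_id)

/-! ### Simple comodules -/

theorem IsSimple.injective {M N : RightComod K C} (hM : M.IsSimple) (g : M ⟶ N)
    (hg : lin g ≠ 0) : Function.Injective (lin g) :=
  LinearMap.ker_eq_bot.1 <| (hM.2 _ (isSubcomodule_ker_lin g)).resolve_right
    fun h => hg (LinearMap.ker_eq_top.1 h)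

theorem IsSimple.surjective {M N : RightComod K C} (hN : N.IsSimple) (g : M ⟶ N)
    (hg : lin g ≠ 0) : Function.Surjective (lin g) :=
  LinearMap.range_eq_top.1 <| (hN.2 _ (isSubcomodule_range g)).resolve_left
    fun h => hg (LinearMap.range_eq_bot.1 h)

/-- Schur's lemma: a nonzero morphism of simple comodules is an isomorphism. -/
theorem IsSimple.nonempty_iso {M N : RightComod K C} (hM : M.IsSimple) (hN : N.IsSimple)
    (g : M ⟶ N) (hg : lin g ≠ 0) : Nonempty (M ≅ N) :=
  ⟨isoOfBijective g ⟨hM.injective g hg, hN.surjective g hg⟩⟩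

theorem IsSimple.of_iso {M N : RightComod K C} (hM : M.IsSimple) (i : M ≅ N) : N.IsSimple := by
  refine ⟨(linIso i).symm.toEquiv.nontrivial_congr.2 hM.1, fun W hW => ?_⟩
  have hs : Function.Surjective (lin i.hom) := fun n => ⟨_, hom_lin_inv_lin i n⟩
  rw [← Submodule.map_comap_eq_of_surjective hs W]
  rcases hM.2 _ (hW.comap i.hom) with h | h
  · exact Or.inl (by rw [h, Submodule.map_bot])
  · exact Or.inr (by rw [h, Submodule.map_top, LinearMap.range_eq_top.2 hs])

/-- The corestriction of a comodule morphism to a subcomodule containing its image. -/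
def corestrict {M N : RightComod K C} (g : M ⟶ N) {W : Submodule K N} (hW : N.IsSubcomodule W)
    (h : ∀ m, lin g m ∈ W) : M ⟶ N.sub W hW :=
  ofDualAct (N := N.sub W hW) ((lin g).codRestrict W h) fun f m =>
    N.subι_injective W hW <| (lin_dualAct g f m).trans
      (lin_dualAct (N.subι W hW) f ((lin g).codRestrict W h m)).symm

/-- The source of an injective morphism is isomorphic to its image. -/
def isoSubRange {M N : RightComod K C} (g : M ⟶ N) (hg : Function.Injective (lin g)) :
    M ≅ N.sub (LinearMap.range (lin g)) (isSubcomodule_range g) :=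
  isoOfBijective (corestrict g _ fun m => ⟨m, rfl⟩)
    ⟨fun _ _ hab => hg (congrArg Subtype.val hab), fun ⟨_, m, hm⟩ => ⟨m, Subtype.ext hm⟩⟩

theorem isSimple_sub_iff {M : RightComod K C} {W : Submodule K M} (hW : M.IsSubcomodule W) :
    (M.sub W hW).IsSimple ↔
      W ≠ ⊥ ∧ ∀ V : Submodule K M, M.IsSubcomodule V → V ≤ W → V = ⊥ ∨ V = W := by
  refine and_congr (Submodule.nontrivial_iff_ne_bot) ⟨fun h V hV hVW => ?_, fun h V hV => ?_⟩
  · have e : (V.comap W.subtype).map W.subtype = V := by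
      rw [Submodule.map_comap_subtype, inf_eq_right.2 hVW]
    rcases h _ (hV.comap (M.subι W hW)) with h | h
    · refine Or.inl (e.symm.trans ?_)
      exact (congrArg (Submodule.map W.subtype) h).trans (Submodule.map_bot _)
    · refine Or.inr (e.symm.trans ?_)
      exact (congrArg (Submodule.map W.subtype) h).trans W.map_subtype_top
  · have inj := Submodule.map_injective_of_injective W.injective_subtype
    rcases h _ (hV.map (M.subι W hW)) (Submodule.map_subtype_le W V) with h | h
    · exact Or.inl (inj (h.trans (Submodule.map_bot W.subtype).symm))
    · exact Or.inr (inj (h.trans W.map_subtype_top.symm))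

/-- Every element of a comodule lies in a finite-dimensional subcomodule. -/
theorem exists_finite_subcomodule (M : RightComod K C) (m : M) :
    ∃ W : Submodule K M, M.IsSubcomodule W ∧ Module.Finite K W ∧ m ∈ W := by
  obtain ⟨V, hV, h⟩ := finite_span_contract (M.coact m)
  -- `W` is the orbit `C^* m`, already a subspace because `f ↦ f m` is linear. It contains `m = ε m`
  -- and sits inside the finite-dimensional `V` that holds every contraction of the coaction of `m`.
  let W : Submodule K M :=
    { carrier := Set.range fun f => M.dualAct f m
      add_mem' := by
        rintro _ _ ⟨f, rfl⟩ ⟨g, rfl⟩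
        refine ⟨f + g, ?_⟩
        simp [dualAct, contract, LinearMap.lTensor_add]
      zero_mem' := ⟨0, by simp [dualAct, contract]⟩
      smul_mem' := by
        rintro a _ ⟨f, rfl⟩
        exact ⟨a • f, by simp [dualAct, contract, LinearMap.lTensor_smul]⟩ }
  refine ⟨W, isSubcomodule_iff.2 ?_, ?_, ⟨CoalgebraStruct.counit, M.dualAct_counit m⟩⟩
  · rintro f _ ⟨g, rfl⟩
    exact ⟨_, (M.dualAct_dualAct f g m).symm⟩
  · refine Submodule.finiteDimensional_of_le (S₂ := V) ?_
    rintro _ ⟨f, rfl⟩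
    exact h f

/-- A nonzero comodule has a simple subcomodule. -/
theorem exists_simple_subcomodule (M : RightComod K C) [Nontrivial M] :
    ∃ (W : Submodule K M) (h : M.IsSubcomodule W), (M.sub W h).IsSimple := by
  obtain ⟨m, hm⟩ := exists_ne (0 : M)
  obtain ⟨W, hW, hf, hmW⟩ := M.exists_finite_subcomodule m
  have hne : W ≠ ⊥ := fun h => hm ((Submodule.mem_bot K).1 (h ▸ hmW))
  -- Descent on dimension: a nonzero finite-dimensional subcomodule is either simple or has a
  -- nonzero proper subcomodule of smaller dimension.
  induction hn : Module.finrank K W using Nat.strong_induction_on generalizing W m with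
  | _ n ih =>
    by_cases hs : ∀ V : Submodule K M, M.IsSubcomodule V → V ≤ W → V = ⊥ ∨ V = W
    · exact ⟨W, hW, (isSimple_sub_iff hW).2 ⟨hne, hs⟩⟩
    · push Not at hs
      obtain ⟨V, hV, hle, h0, hneW⟩ := hs
      obtain ⟨x, hx, hx0⟩ := V.exists_mem_ne_zero_of_ne_bot h0
      exact ih _ (hn ▸ Submodule.finrank_lt_finrank_of_lt (lt_of_le_of_ne hle hneW)) x hx0 V hV
        (Submodule.finiteDimensional_of_le hle) hx h0 rfl

theorem socleSubmodule_eq_of_unique {M : RightComod K C} {W : Submodule K M}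
    (hW : M.IsSubcomodule W) (hs : (M.sub W hW).IsSimple)
    (h : ∀ (V : Submodule K M) (hV : M.IsSubcomodule V), (M.sub V hV).IsSimple → V = W) :
    M.socleSubmodule = W :=
  le_antisymm (sSup_le fun V ⟨hV, hVs⟩ => (h V hV hVs).le) (le_sSup ⟨hW, hs⟩)

/-! ### Injective envelopes -/

/-- The kernel of `f` meets the image of `j` trivially, so it vanishes by essentiality. -/
theorem injective_of_essential {M E F : RightComod K C} {j : M ⟶ E}
    (hj : IsInjectiveEnvelope j) (f : E ⟶ F) (hf : Function.Injective (lin (j ≫ f))) :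
    Function.Injective (lin f) := by
  refine LinearMap.ker_eq_bot.1 (hj.essential _ (isSubcomodule_ker_lin f) ?_)
  rw [eq_bot_iff]
  rintro _ ⟨hx, m, rfl⟩
  have : m = 0 := hf ((LinearMap.mem_ker.1 hx).trans (map_zero _).symm)
  simp [this]

/-- Injective envelopes are unique up to isomorphism. -/
theorem IsInjectiveEnvelope.nonempty_iso {M E E' : RightComod K C} {j : M ⟶ E} {j' : M ⟶ E'}
    (hj : IsInjectiveEnvelope j) (hj' : IsInjectiveEnvelope j') : Nonempty (E ≅ E') := by
  have := hj.injective_obj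
  have := hj'.injective_obj
  have := mono_of_injective j hj.injective_map
  let f : E ⟶ E' := Injective.factorThru j' j
  have hf : j ≫ f = j' := Injective.comp_factorThru j' j
  have fi := injective_of_essential hj f (hf ▸ hj'.injective_map)
  have := mono_of_injective f fi
  let g : E' ⟶ E := Injective.factorThru (𝟙 E) f
  have hg : f ≫ g = 𝟙 E := Injective.comp_factorThru (𝟙 E) f
  have hfg : ∀ x, lin g (lin f x) = x := LinearMap.congr_fun (congrArg lin hg)
  -- `g` is only a left inverse of `f`. Essentiality of `j'` makes it injective, and then `g (f (g
  -- y)) = g y` gives surjectivity of `f`.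
  have gi : Function.Injective (lin g) := by
    refine injective_of_essential hj' g ?_
    rw [← hf, Category.assoc, hg, Category.comp_id]
    exact hj.injective_map
  exact ⟨isoOfBijective f ⟨fi, fun y => ⟨lin g y, gi (hfg _)⟩⟩⟩

/-! ### Indecomposable comodules -/

/-- The projection onto a subcomodule along a complementary subcomodule. -/
def projection {M : RightComod K C} {W W' : Submodule K M} (hW : M.IsSubcomodule W)
    (hW' : M.IsSubcomodule W') (h : IsCompl W W') : M ⟶ M :=
  ofDualAct (W.projection W' h) fun f m => by
    obtain ⟨a, b, rfl⟩ : ∃ (a : W) (b : W'), (a : M) + b = m := by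
      obtain ⟨a, ha, b, hb, hab⟩ := Submodule.mem_sup.1 (h.sup_eq_top ▸ Submodule.mem_top (x := m))
      exact ⟨⟨a, ha⟩, ⟨b, hb⟩, hab⟩
    have key : ∀ a ∈ W, ∀ b ∈ W', W.projection W' h (a + b) = a := fun a ha b hb => by
      rw [map_add, Submodule.projection_apply_of_mem_left h ha,
        Submodule.projection_apply_of_mem_right h hb, add_zero]
    rw [map_add, key _ (isSubcomodule_iff.1 hW f a a.2) _ (isSubcomodule_iff.1 hW' f b b.2),
      key a a.2 b b.2]

/-- An idempotent splits `M` as the direct sum of its range and its kernel. -/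
theorem IsIndecomposable.eq_zero_or_eq_id {M : RightComod K C} (hM : M.IsIndecomposable)
    (p : M ⟶ M) (hp : p ≫ p = p) : lin p = 0 ∨ lin p = LinearMap.id := by
  have hi : IsIdempotentElem (lin p) := congrArg lin hp
  rcases hM.2 _ _ (isSubcomodule_range p) (isSubcomodule_ker_lin p)
    (LinearMap.IsIdempotentElem.isCompl hi) with h | h
  · exact Or.inl (LinearMap.range_eq_bot.1 h)
  · refine Or.inr (LinearMap.ext fun x => LinearMap.ker_eq_bot.1 h ?_)
    exact LinearMap.congr_fun hi x

instance (M N : RightComod K C) : Zero (M ⟶ N) := ⟨ofLin 0 (by simp)⟩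

@[simp] theorem lin_zero (M N : RightComod K C) : lin (0 : M ⟶ N) = 0 := rfl

end RightComod

open RightComod in
/-- A fully faithful functor between categories of comodules maps an indecomposable comodule to an
indecomposable comodule, unless it maps it to zero. -/
theorem isIndecomposable_obj_of_fullyFaithful {K : Type u} {C D : Type v} [Field K]
    [AddCommGroup C] [Module K C] [Coalgebra K C] [AddCommGroup D] [Module K D] [Coalgebra K D]
    (F : RightComod K D ⥤ RightComod K C) [F.Full] [F.Faithful] {N : RightComod K D}
    (hN : N.IsIndecomposable) (h : Nontrivial (F.obj N)) : (F.obj N).IsIndecomposable := by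
  refine ⟨h, fun W W' hW hW' hc => ?_⟩
  let p := projection hW hW' hc
  have hp : p ≫ p = p := hom_ext <| LinearMap.ext fun x =>
    Submodule.projection_apply_of_mem_left hc (Submodule.projection_apply_mem hc x)
  obtain ⟨r, hr⟩ := F.map_surjective p
  have hrr : r ≫ r = r := F.map_injective (by rw [F.map_comp, hr, hp])
  rcases hN.eq_zero_or_eq_id r hrr with h0 | h1
  · left
    -- `F` is not assumed additive, so `F(0) = 0` needs an argument: with `z` a preimage of the zero
    -- endomorphism, `r = r ≫ z` because `r` is zero, hence `F(r) = F(r) ≫ 0 = 0`.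
    obtain ⟨z, hz⟩ := F.map_surjective (0 : F.obj N ⟶ F.obj N)
    have e : r ≫ z = r := hom_ext (by simp [h0])
    have : p = 0 := by
      rw [← hr, ← e, F.map_comp, hz]
      exact hom_ext (by simp)
    rw [← Submodule.range_projection hc]
    exact LinearMap.range_eq_bot.2 (congrArg lin this)
  · right
    have : p = 𝟙 _ := by
      rw [← hr, show r = 𝟙 _ from hom_ext h1, F.map_id]
    rw [← Submodule.ker_projection hc]
    exact LinearMap.ker_eq_bot'.2 fun x hx => (LinearMap.congr_fun (congrArg lin this) x).symm.trans hx

open RightComod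

variable {K : Type u} {C : Type v} [Field K] [AddCommGroup C] [Module K C] [Coalgebra K C]
  (e : DualIdempotent K C)

/-! ### The unit of the adjunction -/

theorem counit_rAct (c : C) : CoalgebraStruct.counit (R := K) (rAct e c) = e.1.ofConv c := by
  have h : ∀ s : C ⊗[K] C, CoalgebraStruct.counit (R := K)
      (TensorProduct.lid K C (e.1.ofConv.rTensor C s)) =
      e.1.ofConv (TensorProduct.rid K C
        ((CoalgebraStruct.counit (R := K) (A := C)).lTensor C s)) := by
    intro s
    induction s with
    | zero => simp
    | add a b ha hb => simp only [map_add, ha, hb]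
    | tmul x y => simp [mul_comm]
  refine (h _).trans ?_
  rw [Coalgebra.lTensor_counit_comul]
  simp

/-- The morphism `m ↦ ∑ e m₀ ⊗ m₁ e` from `M` to `eM ⊗ Ce`. -/
def toTensor (M : RightComod K C) :
    M ⟶ tensorComod (quotObj e M) (rightBicomod e).toRightComod :=
  ofLin (N := tensorComod (quotObj e M) (rightBicomod e).toRightComod)
    (TensorProduct.map (actProj e M) (rightProj e) ∘ₗ M.coact) fun m => by
  change (TensorProduct.assoc K (actRange e M) (rightPart e) C).symm
      ((rightPartCoact e).lTensor _ (TensorProduct.map (actProj e M) (rightProj e) (M.coact m))) =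
    (TensorProduct.map (actProj e M) (rightProj e) ∘ₗ M.coact).rTensor C (M.coact m)
  rw [lTensor_map (rightPartCoact_rightProj e), LinearEquiv.symm_apply_eq, ← M.coassoc,
    LinearMap.rTensor_comp, LinearMap.comp_apply]
  generalize M.coact.rTensor C (M.coact m) = s
  induction s with
  | zero => simp
  | add a b ha hb => simp only [map_add, ha, hb]
  | tmul t c =>
    rw [LinearMap.rTensor_tmul]
    induction t with
    | zero => simp
    | add a b ha hb => simp only [map_add, TensorProduct.add_tmul, ha, hb]
    | tmul x y => simp

/-- Both terms of the difference are the image of the twice-iterated coaction, projected to `eM ⊗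
(eCe ⊗ Ce)`. -/
theorem cotensorMap_toTensor (M : RightComod K C) (m : M) :
    cotensorMap (quotObj e M) (rightBicomod e) (lin (toTensor e M) m) = 0 := by
  refine sub_eq_zero.2 ?_
  change TensorProduct.assoc K (actRange e M) (corner e) (rightPart e)
      ((quotCoact e M).rTensor _ (TensorProduct.map (actProj e M) (rightProj e) (M.coact m))) =
    (rightPartLCoact e).lTensor _ (TensorProduct.map (actProj e M) (rightProj e) (M.coact m))
  rw [assoc_rTensor_map (quotCoact_actProj e M), lTensor_map (rightPartLCoact_rightProj e),
    M.coassoc]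

/-- The unit `M ⟶ S(T(M))`, `m ↦ ∑ e m₀ ⊗ m₁ e`. -/
def unitHom (M : RightComod K C) : M ⟶ (sectionFunctor e).obj ((quotientFunctor e).obj M) :=
  corestrict (toTensor e M) (isSubcomodule_cotensor _ _) (cotensorMap_toTensor e M)

/-- The inclusion `N □ Ce ⟶ N ⊗ Ce`. -/
def sectionι (N : RightComod K (corner e)) :
    (sectionFunctor e).obj N ⟶ tensorComod N (rightBicomod e).toRightComod :=
  subι _ _ (isSubcomodule_cotensor N (rightBicomod e))

theorem sectionι_injective (N : RightComod K (corner e)) :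
    Function.Injective (lin (sectionι e N)) := subι_injective _ _ _

/-! ### The counit of the adjunction -/

theorem tensor_rightPart_induction {N : Type*} [AddCommGroup N] [Module K N]
    {P : N ⊗[K] rightPart e → Prop} (t : N ⊗[K] rightPart e) (zero : P 0)
    (add : ∀ a b, P a → P b → P (a + b)) (tmul : ∀ n c, P (n ⊗ₜ rightProj e c)) : P t := by
  induction t with
  | zero => exact zero
  | add a b ha hb => exact add a b ha hb
  | tmul n x =>
    obtain ⟨c, rfl⟩ := rightProj_surjective e x
    exact tmul n c

/-- The restriction to `Ce` of the counit of `C`. -/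
def rightCounit : rightPart e →ₗ[K] K := CoalgebraStruct.counit ∘ₗ (rightPart e).subtype

@[simp] theorem rightCounit_rightProj (c : C) : rightCounit e (rightProj e c) = e.1.ofConv c :=
  counit_rAct e c

/-- The map `xe ↦ exe` from `Ce` to `eCe`. -/
def rightToCorner : rightPart e →ₗ[K] corner e := cornerProj e ∘ₗ (rightPart e).subtype

@[simp] theorem rightToCorner_rightProj (c : C) :
    rightToCorner e (rightProj e c) = cornerProj e c := cornerProj_rAct e c

/-- The inclusion of `eCe` into `Ce`. -/
def cornerToRight : corner e →ₗ[K] rightPart e := rightProj e ∘ₗ (corner e).subtype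

@[simp] theorem cornerToRight_cornerProj (c : C) :
    cornerToRight e (cornerProj e c) = rightProj e (lAct e c) := by
  change rightProj e (lAct e (rAct e c)) = _
  rw [lAct_rAct, rightProj_rAct]

variable (N : RightComod K (corner e))

/-- On `Ce` the action of `e` is `ce ↦ ece`, the projection onto `eCe` followed by its inclusion
into `Ce`. -/
theorem act_tensor (t : N ⊗[K] rightPart e) :
    act e (tensorComod N (rightBicomod e).toRightComod) t =
      (cornerToRight e ∘ₗ rightToCorner e).lTensor N t := by
  induction t using tensor_rightPart_induction with
  | zero => exact (map_zero _).trans (map_zero _).symm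
  | add a b ha hb => exact (map_add _ a b).trans ((congrArg₂ _ ha hb).trans (map_add _ a b).symm)
  | tmul n c =>
    change contract (N ⊗[K] rightPart e) e.1.ofConv
      ((TensorProduct.assoc K N (rightPart e) C).symm (n ⊗ₜ rightPartCoact e (rightProj e c))) = _
    rw [rightPartCoact_rightProj, LinearMap.lTensor_tmul, LinearMap.comp_apply,
      rightToCorner_rightProj, cornerToRight_cornerProj, lAct, LinearMap.comp_apply,
      LinearMap.comp_apply]
    generalize CoalgebraStruct.comul (R := K) c = s
    induction s with
    | zero => simp
    | add a b ha hb => simp only [map_add, TensorProduct.tmul_add, ha, hb]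
    | tmul x y => simp

theorem rightCounit_cornerToRight (x : corner e) :
    rightCounit e (cornerToRight e x) = CoalgebraStruct.counit x := by
  obtain ⟨c, rfl⟩ := cornerProj_surjective e x
  rw [cornerToRight_cornerProj, rightCounit_rightProj, e_lAct, counit_cornerProj]

theorem contract_lTensor {M V W : Type*} [AddCommGroup M] [Module K M] [AddCommGroup V]
    [Module K V] [AddCommGroup W] [Module K W] (f : W →ₗ[K] K) (g : V →ₗ[K] W)
    (t : M ⊗[K] V) : contract M f (g.lTensor M t) = contract M (f ∘ₗ g) t := by
  induction t with
  | zero => simp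
  | add a b ha hb => simp only [map_add, ha, hb]
  | tmul x y => simp

/-- Holds because `ε(ece) = e(c) = ε(ce)`. -/
theorem contract_act (t : N ⊗[K] rightPart e) :
    contract N (rightCounit e) (act e (tensorComod N (rightBicomod e).toRightComod) t) =
      contract N (rightCounit e) t := by
  rw [act_tensor, contract_lTensor]
  congr 2
  refine LinearMap.ext fun x => ?_
  obtain ⟨c, rfl⟩ := rightProj_surjective e x
  simp [e_lAct]

/-- Apply `1 ⊗ 1 ⊗ ε` to the equation `ρ_N ⊗ 1 = 1 ⊗ λ` satisfied by `t`; on the right, `∑ e c₁ e ⊗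
c₂ e` contracts to `ece`. -/
theorem coact_contract (t : N ⊗[K] rightPart e)
    (ht : cotensorMap N (rightBicomod e) t = 0) :
    N.coact (contract N (rightCounit e) t) = (rightToCorner e).lTensor N t := by
  have h1 : ∀ t : N ⊗[K] rightPart e, (contract (corner e) (rightCounit e)).lTensor N
      (TensorProduct.assoc K N (corner e) (rightPart e) (N.coact.rTensor _ t)) =
      N.coact (contract N (rightCounit e) t) := by
    intro t
    induction t with
    | zero => simp
    | add a b ha hb => simp only [map_add, ha, hb]
    | tmul n x =>
      rw [LinearMap.rTensor_tmul, contract_tmul, map_smul]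
      generalize N.coact n = s
      induction s with
      | zero => simp
      | add a b ha hb => simp only [map_add, TensorProduct.add_tmul, smul_add, ha, hb]
      | tmul n d => simp
  have h2 : ∀ t : N ⊗[K] rightPart e, (contract (corner e) (rightCounit e)).lTensor N
      ((rightPartLCoact e).lTensor N t) = (rightToCorner e).lTensor N t := by
    intro t
    induction t using tensor_rightPart_induction with
    | zero => simp
    | add a b ha hb => simp only [map_add, ha, hb]
    | tmul n c =>
      simp only [LinearMap.lTensor_tmul, rightToCorner_rightProj, rightPartLCoact_rightProj]
      rw [← cornerProj_lAct, lAct, LinearMap.comp_apply, LinearMap.comp_apply]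
      generalize CoalgebraStruct.comul (R := K) c = s
      induction s with
      | zero => simp
      | add a b ha hb => simp only [map_add, TensorProduct.tmul_add, ha, hb]
      | tmul x y => simp
  rw [← h1, ← h2]
  exact congrArg _ (sub_eq_zero.1 ht)

/-- The linear map `e(N ⊗ Ce) → N` given by the counit of `C`. -/
def quotTensorCounit : actRange e (tensorComod N (rightBicomod e).toRightComod) →ₗ[K] N :=
  contract N (rightCounit e) ∘ₗ (actRange e (tensorComod N (rightBicomod e).toRightComod)).subtype

theorem quotTensorCounit_actProj (t : N ⊗[K] rightPart e) :
    quotTensorCounit e N (actProj e _ t) = contract N (rightCounit e) t := contract_act e N t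

/-- The coaction of `n ⊗ ce` is `∑ n ⊗ c₁e ⊗ c₂`, and contracting the middle factor leaves `n ⊗ ∑
e(c₁) c₂ = n ⊗ ce`. It serves both colinearity of the counit (`g` the projection to `eCe`) and a
triangle identity (`g` the projection to `Ce`). -/
theorem map_contract_coact_tensor {V : Type*} [AddCommGroup V] [Module K V] (g : C →ₗ[K] V)
    (t : N ⊗[K] rightPart e) :
    TensorProduct.map (contract N (rightCounit e)) g
      ((tensorComod N (rightBicomod e).toRightComod).coact t) =
    (g ∘ₗ (rightPart e).subtype).lTensor N t := by
  change TensorProduct.map (contract N (rightCounit e)) g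
    ((TensorProduct.assoc K N (rightPart e) C).symm ((rightPartCoact e).lTensor N t)) = _
  induction t using tensor_rightPart_induction with
  | zero => simp
  | add a b ha hb => simp only [map_add, ha, hb]
  | tmul n c =>
    rw [LinearMap.lTensor_tmul, rightPartCoact_rightProj]
    change _ = n ⊗ₜ[K] g (rAct e c)
    rw [rAct, LinearMap.comp_apply, LinearMap.comp_apply]
    generalize CoalgebraStruct.comul (R := K) c = s
    induction s with
    | zero => simp
    | add a b ha hb => simp only [map_add, TensorProduct.tmul_add, ha, hb]
    | tmul x y => simp [TensorProduct.smul_tmul]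

/-- One half of the colinearity of the counit, valid on all of `N ⊗ Ce`; the other half,
`coact_contract`, needs the cotensor condition. -/
theorem rTensor_quotTensorCounit (t : N ⊗[K] rightPart e) :
    (quotTensorCounit e N).rTensor (corner e) (quotCoact e _ (actProj e _ t)) =
      (rightToCorner e).lTensor N t := by
  refine (congrArg _ (quotCoact_actProj e (tensorComod N (rightBicomod e).toRightComod) t)).trans ?_
  rw [LinearMap.rTensor, ← LinearMap.comp_apply, ← TensorProduct.map_comp,
    show quotTensorCounit e N ∘ₗ actProj e _ = contract N (rightCounit e) from
      LinearMap.ext (quotTensorCounit_actProj e N)]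
  exact map_contract_coact_tensor e N _ t

/-- The counit `T(S(N)) ⟶ N`. -/
def counitHom : (quotientFunctor e).obj ((sectionFunctor e).obj N) ⟶ N :=
  ofLin (M := quotObj e ((sectionFunctor e).obj N))
    (quotTensorCounit e N ∘ₗ lin (quotMap e (sectionι e N))) fun x => by
  obtain ⟨t, rfl⟩ := actProj_surjective e _ x
  have h : lin (quotMap e (sectionι e N)) (actProj e _ t) =
      actProj e _ (lin (sectionι e N) t) := Subtype.ext (lin_act e (sectionι e N) t)
  have h1 := lin_coact (quotMap e (sectionι e N)) (actProj e _ t)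
  rw [h] at h1
  refine Eq.trans (congrArg N.coact ((congrArg (quotTensorCounit e N) h).trans
    (quotTensorCounit_actProj e N _))) ?_
  refine Eq.trans (coact_contract e N _ t.2) ?_
  refine (rTensor_quotTensorCounit e N (lin (sectionι e N) t)).symm.trans ?_
  refine (congrArg _ h1).trans ?_
  exact (LinearMap.congr_fun (LinearMap.rTensor_comp (corner e) (quotTensorCounit e N)
    (lin (quotMap e (sectionι e N)))) _).symm

theorem counitHom_actProj (t : (sectionFunctor e).obj N) :
    lin (counitHom e N) (actProj e _ t) =
      contract N (rightCounit e) (lin (sectionι e N) t) := by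
  refine Eq.trans ?_ (contract_act e N (lin (sectionι e N) t))
  exact congrArg (contract N (rightCounit e)) (lin_act e (sectionι e N) t)

/-- If `(1 ⊗ ε) t = 0`, then `coact_contract` kills the image of `t` in `N ⊗ eCe`, and `e t` is that
image included in `N ⊗ Ce`. -/
theorem counitHom_injective : Function.Injective (lin (counitHom e N)) := by
  rw [← LinearMap.ker_eq_bot, LinearMap.ker_eq_bot']
  intro x hx
  obtain ⟨t, rfl⟩ := actProj_surjective e _ x
  rw [counitHom_actProj] at hx
  refine Subtype.ext (sectionι_injective e N ?_)
  have h := coact_contract e N (lin (sectionι e N) t) t.2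
  rw [hx, map_zero] at h
  change lin (sectionι e N) (act e _ t) = 0
  refine (lin_act e (sectionι e N) t).trans ((act_tensor e N _).trans ?_)
  rw [LinearMap.lTensor_comp]
  exact (congrArg ((cornerToRight e).lTensor N) h.symm).trans (map_zero _)

/-- Coassociativity of `N`, since on `eCe ⊆ Ce` the left coaction of `Ce` is the comultiplication of
`eCe`. These elements provide the preimages under the counit. -/
theorem cotensorMap_lTensor_coact (n : N) :
    cotensorMap N (rightBicomod e) ((cornerToRight e).lTensor N (N.coact n)) = 0 := by
  refine sub_eq_zero.2 ?_
  change TensorProduct.assoc K N (corner e) (rightPart e)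
      (N.coact.rTensor _ (TensorProduct.map LinearMap.id (cornerToRight e) (N.coact n))) =
    (rightPartLCoact e).lTensor _ (TensorProduct.map LinearMap.id (cornerToRight e) (N.coact n))
  rw [assoc_rTensor_map (β := N.coact) (v := LinearMap.id) (w := LinearMap.id)
      (fun b => by simp),
    lTensor_map (γ := CoalgebraStruct.comul) (w := LinearMap.id) (z := cornerToRight e) ?_,
    N.coassoc]
  intro x
  obtain ⟨c, rfl⟩ := cornerProj_surjective e x
  rw [cornerToRight_cornerProj, rightPartLCoact_rightProj, comul_lAct, comul_cornerProj]
  generalize CoalgebraStruct.comul (R := K) c = s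
  induction s with
  | zero => simp
  | add a b ha hb => simp only [map_add, ha, hb]
  | tmul x y => simp

theorem counitHom_surjective : Function.Surjective (lin (counitHom e N)) := by
  intro n
  refine ⟨actProj e _ ⟨_, cotensorMap_lTensor_coact e N n⟩, (counitHom_actProj e N _).trans ?_⟩
  change contract N (rightCounit e) ((cornerToRight e).lTensor N (N.coact n)) = n
  rw [contract_lTensor, show rightCounit e ∘ₗ cornerToRight e = CoalgebraStruct.counit from
    LinearMap.ext (rightCounit_cornerToRight e)]
  exact N.dualAct_counit n

/-! ### The adjunction -/

/-- The quotient functor is left adjoint to the section functor. -/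
def quotientSectionAdj : quotientFunctor e ⊣ sectionFunctor e :=
  Adjunction.mkOfUnitCounit
    { unit :=
        { app := unitHom e
          naturality := fun M M' f => hom_ext <| LinearMap.ext fun m => by
            apply sectionι_injective
            let g : actRange e M →ₗ[K] actRange e M' := lin (quotMap e f)
            have h : ∀ x, g (actProj e M x) = actProj e M' (lin f x) :=
              fun x => Subtype.ext (lin_act e f x)
            change TensorProduct.map (actProj e M') (rightProj e) (M'.coact (lin f m)) =
              g.rTensor (rightPart e) (TensorProduct.map (actProj e M) (rightProj e) (M.coact m))
            rw [lin_coact]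
            generalize M.coact m = s
            induction s with
            | zero => simp
            | add a b ha hb => simp only [map_add, ha, hb]
            | tmul x y => simp [h] }
      counit :=
        { app := counitHom e
          naturality := fun N N' f => hom_ext <| LinearMap.ext fun x => by
            exact contract_rTensor (rightCounit e) (lin f) _ }
      left_triangle := by
        refine NatTrans.ext (funext fun M => hom_ext (LinearMap.ext fun x => ?_))
        obtain ⟨m, rfl⟩ := actProj_surjective e M x
        change contract (actRange e M) (rightCounit e)
          (TensorProduct.map (actProj e M) (rightProj e) (M.coact (act e M m))) = actProj e M m
        have h : ∀ s, contract (actRange e M) (rightCounit e)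
            (TensorProduct.map (actProj e M) (rightProj e) s) =
            actProj e M (contract M e.1.ofConv s) := by
          intro s
          induction s with
          | zero => simp
          | add a b ha hb => simp only [map_add, ha, hb]
          | tmul x y => simp
        rw [h]
        change actProj e M (act e M (act e M m)) = _
        rw [actProj_act, actProj_act]
      right_triangle := by
        refine NatTrans.ext (funext fun N => hom_ext (LinearMap.ext fun t =>
          sectionι_injective e N ?_))
        let g : actRange e ((sectionFunctor e).obj N) →ₗ[K] N := lin (counitHom e N)
        let j : (sectionFunctor e).obj N →ₗ[K] N ⊗[K] rightPart e := lin (sectionι e N)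
        have hg : g ∘ₗ actProj e _ = contract N (rightCounit e) ∘ₗ j :=
          LinearMap.ext (counitHom_actProj e N)
        have h1 : ∀ s, g.rTensor (rightPart e) (TensorProduct.map (actProj e _) (rightProj e) s) =
            TensorProduct.map (contract N (rightCounit e)) (rightProj e) (j.rTensor C s) := by
          intro s
          rw [LinearMap.rTensor, LinearMap.rTensor, ← LinearMap.comp_apply,
            ← LinearMap.comp_apply, ← TensorProduct.map_comp, ← TensorProduct.map_comp, hg,
            LinearMap.id_comp, LinearMap.comp_id]
        refine (h1 _).trans ((congrArg _ (lin_coact (sectionι e N) t).symm).trans ?_)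
        refine (map_contract_coact_tensor e N (rightProj e) (lin (sectionι e N) t)).trans ?_
        have hid : rightProj e ∘ₗ (rightPart e).subtype = LinearMap.id := by
          refine LinearMap.ext fun x => ?_
          obtain ⟨c, rfl⟩ := rightProj_surjective e x
          exact rightProj_rAct e c
        rw [hid]
        exact LinearMap.lTensor_id_apply _ _ _ }

/-- The counit is an isomorphism `T(S(N)) ≅ N`. -/
def counitIso : (quotientFunctor e).obj ((sectionFunctor e).obj N) ≅ N :=
  isoOfBijective (counitHom e N) ⟨counitHom_injective e N, counitHom_surjective e N⟩

instance : IsIso (quotientSectionAdj e).counit := by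
  have : ∀ N, IsIso ((quotientSectionAdj e).counit.app N) := fun N => (counitIso e N).isIso_hom
  exact NatIso.isIso_of_isIso_app _

/-- A right adjoint whose counit is invertible is fully faithful. -/
instance : (sectionFunctor e).Full := (quotientSectionAdj e).fullyFaithfulROfIsIsoCounit.full

instance : (sectionFunctor e).Faithful :=
  (quotientSectionAdj e).fullyFaithfulROfIsIsoCounit.faithful

/-! ### Torsion -/

theorem isTorsion_iff {M : RightComod K C} : IsTorsion e M ↔ ∀ m, act e M m = 0 :=
  ⟨fun h m => congrArg Subtype.val (h.elim (actProj e M m) 0), fun h =>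
    ⟨fun x y => by
      obtain ⟨m, rfl⟩ := actProj_surjective e M x
      obtain ⟨m', rfl⟩ := actProj_surjective e M y
      exact Subtype.ext ((h m).trans (h m').symm)⟩⟩

theorem nontrivial_quotObj_iff {M : RightComod K C} :
    Nontrivial ((quotientFunctor e).obj M) ↔ ¬ IsTorsion e M :=
  not_subsingleton_iff_nontrivial.symm

theorem nontrivial_sectionObj {N : RightComod K (corner e)} (h : Nontrivial N) :
    Nontrivial ((sectionFunctor e).obj N) := by
  by_contra hs
  rw [not_nontrivial_iff_subsingleton] at hs
  obtain ⟨n, hn⟩ := exists_ne (0 : N)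
  obtain ⟨x, rfl⟩ := counitHom_surjective e N n
  exact hn ((congrArg _ (Subtype.ext (Subsingleton.elim (Subtype.val x) 0))).trans (map_zero _))

/-- The morphism `T(M) ⟶ N` adjoint to a morphism `M ⟶ S(N)`. -/
def transpose {M : RightComod K C} {N : RightComod K (corner e)}
    (g : M ⟶ (sectionFunctor e).obj N) : (quotientFunctor e).obj M ⟶ N :=
  (quotientFunctor e).map g ≫ counitHom e N

theorem transpose_injective {M : RightComod K C} {N : RightComod K (corner e)} :
    Function.Injective (transpose e (M := M) (N := N)) := fun g g' h => by
  apply ((quotientSectionAdj e).homEquiv M N).symm.injective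
  rw [Adjunction.homEquiv_counit, Adjunction.homEquiv_counit]
  exact h

theorem exists_transpose_eq {M : RightComod K C} {N : RightComod K (corner e)}
    (f : (quotientFunctor e).obj M ⟶ N) : ∃ g, transpose e g = f := by
  refine ⟨(quotientSectionAdj e).homEquiv M N f, ?_⟩
  refine Eq.trans ?_ (((quotientSectionAdj e).homEquiv M N).symm_apply_apply f)
  rw [Adjunction.homEquiv_counit]
  rfl

theorem transpose_actProj {M : RightComod K C} {N : RightComod K (corner e)}
    (g : M ⟶ (sectionFunctor e).obj N) (m : M) :
    lin (transpose e g) (actProj e M m) = lin (counitHom e N) (actProj e _ (lin g m)) :=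
  congrArg (lin (counitHom e N)) (Subtype.ext (lin_act e g m))

/-- The transpose of `g` depends only on the restriction of `g` to `eM`, and transposition is
injective. -/
theorem eq_zero_of_act_eq_zero {M : RightComod K C} {N : RightComod K (corner e)}
    (g : M ⟶ (sectionFunctor e).obj N) (h : ∀ m, lin g (act e M m) = 0) : g = 0 := by
  apply transpose_injective e
  refine hom_ext (LinearMap.ext fun x => ?_)
  obtain ⟨m, rfl⟩ := actProj_surjective e M x
  have h1 : actProj e _ (lin g m) = 0 := Subtype.ext ((lin_act e g m).symm.trans (h m))
  refine (transpose_actProj e g m).trans (Eq.trans ?_ (transpose_actProj e 0 m).symm)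
  refine congrArg _ (h1.trans ?_)
  exact (map_zero _).symm

/-- The image of the section functor consists of torsion-free comodules. -/
theorem isTorsionFree_sectionObj (N : RightComod K (corner e)) :
    IsTorsionFree e ((sectionFunctor e).obj N) := by
  intro W h hW
  have h0 : subι _ W h = 0 := eq_zero_of_act_eq_zero e _ fun m => by
    rw [(isTorsion_iff e).1 hW, map_zero]
  rw [← range_subι _ W h, h0]
  exact LinearMap.range_zero

/-! ### Simple comodules -/

theorem contract_map {M N V W : Type*} [AddCommGroup M] [Module K M] [AddCommGroup N]
    [Module K N] [AddCommGroup V] [Module K V] [AddCommGroup W] [Module K W] (f : W →ₗ[K] K)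
    (g : V →ₗ[K] W) (p : M →ₗ[K] N) (t : M ⊗[K] V) :
    contract N f (TensorProduct.map p g t) = p (contract M (f ∘ₗ g) t) := by
  induction t with
  | zero => simp
  | add a b ha hb => simp only [map_add, ha, hb]
  | tmul x y => simp

theorem dualAct_act (M : RightComod K C) (f : C →ₗ[K] K) (m : M) :
    M.dualAct f (act e M m) = M.dualAct (f ∘ₗ lAct e) m := by
  refine (congrArg (contract M f) (coact_act e M m)).trans ?_
  exact contract_lTensor f (lAct e) _

theorem act_dualAct (M : RightComod K C) (f : C →ₗ[K] K) (m : M) :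
    act e M (M.dualAct f m) = M.dualAct (f ∘ₗ rAct e) m := by
  refine (M.dualAct_dualAct e.1.ofConv f m).trans ?_
  congr 2
  refine LinearMap.ext fun c => ?_
  simp only [rAct, LinearMap.comp_apply]
  generalize CoalgebraStruct.comul (R := K) c = s
  induction s with
  | zero => simp
  | add a b ha hb => simp only [map_add, ha, hb]
  | tmul x y => simp [mul_comm]

theorem dualAct_quotObj (M : RightComod K C) (f : corner e →ₗ[K] K) (m : M) :
    (quotObj e M).dualAct f (actProj e M m) = actProj e M (M.dualAct (f ∘ₗ cornerProj e) m) := by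
  refine (congrArg (contract (actRange e M) f) (quotCoact_actProj e M m)).trans ?_
  exact contract_map f (cornerProj e) (actProj e M) _

/-- The functional `e * f * e` depends only on the restriction of `f` to `eCe`, so moving inside `M`
and returning to `eM` stays within the `eCe`-action on `eM`. -/
theorem actProj_dualAct_act (M : RightComod K C) (f : C →ₗ[K] K) (m : M) :
    actProj e M (M.dualAct f (act e M m)) =
      (quotObj e M).dualAct (f ∘ₗ (corner e).subtype) (actProj e M m) := by
  rw [dualAct_quotObj, dualAct_act]
  refine Subtype.ext ?_
  change act e M _ = act e M (M.dualAct (f ∘ₗ lAct e ∘ₗ rAct e) m)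
  rw [act_dualAct, act_dualAct]
  congr 2
  exact LinearMap.ext fun c => congrArg (fun x => f (lAct e x)) (rAct_rAct e c).symm

/-- The functor `T` maps a simple comodule to a simple comodule, unless it maps it to zero. -/
theorem isSimple_quotObj {M : RightComod K C} (hM : M.IsSimple) (ht : ¬ IsTorsion e M) :
    ((quotientFunctor e).obj M).IsSimple := by
  refine ⟨(nontrivial_quotObj_iff e).2 ht, fun (V : Submodule K (actRange e M)) hV => ?_⟩
  -- The largest subcomodule `W` of `M` with `eW ⊆ V`. If it is zero then `V = 0`, because `V ⊆ W`
  -- by `actProj_dualAct_act`; if it is all of `M` then `V = eM`.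
  let W : Submodule K M := ⨅ f : C →ₗ[K] K, V.comap (actProj e M ∘ₗ M.dualAct f)
  have mem_W : ∀ m, m ∈ W ↔ ∀ f, actProj e M (M.dualAct f m) ∈ V := fun m => by
    simp [W, Submodule.mem_iInf]
  have hW : M.IsSubcomodule W := by
    refine isSubcomodule_iff.2 fun f m hm => (mem_W _).2 fun g => ?_
    rw [dualAct_dualAct]
    exact (mem_W m).1 hm _
  rcases hM.2 W hW with h | h
  · left
    refine (Submodule.eq_bot_iff V).2 fun x hx => ?_
    obtain ⟨m, rfl⟩ := actProj_surjective e M x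
    have : act e M m ∈ W := (mem_W _).2 fun f => by
      rw [actProj_dualAct_act]
      exact isSubcomodule_iff.1 hV _ _ hx
    rw [h] at this
    exact Subtype.ext this
  · right
    refine Submodule.eq_top_iff'.2 fun (x : actRange e M) => ?_
    obtain ⟨m, rfl⟩ := actProj_surjective e M x
    have := (mem_W m).1 (h ▸ Submodule.mem_top) CoalgebraStruct.counit
    rwa [dualAct_counit] at this

theorem lin_transpose_ne_zero {M : RightComod K C} {N : RightComod K (corner e)}
    {g : M ⟶ (sectionFunctor e).obj N} (hg : lin g ≠ 0) : lin (transpose e g) ≠ 0 := by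
  intro h
  have : transpose e g = transpose e 0 := hom_ext <| h.trans <| LinearMap.ext fun x => by
    obtain ⟨m, rfl⟩ := actProj_surjective e M x
    refine Eq.trans ?_ (transpose_actProj e 0 m).symm
    exact ((congrArg _ (map_zero (actProj e _))).trans (map_zero _)).symm
  exact hg (congrArg lin (transpose_injective e this))

theorem lin_ne_zero_of_transpose {M : RightComod K C} {N : RightComod K (corner e)}
    {g : M ⟶ (sectionFunctor e).obj N} (hg : lin (transpose e g) ≠ 0) : lin g ≠ 0 := by
  intro h
  refine hg (LinearMap.ext fun x => ?_)
  obtain ⟨m, rfl⟩ := actProj_surjective e M x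
  refine (transpose_actProj e g m).trans ?_
  rw [h]
  exact (congrArg _ (map_zero (actProj e _))).trans (map_zero _)

theorem lin_subι_ne_zero {D : Type v} [AddCommGroup D] [Module K D] [Coalgebra K D]
    (M : RightComod K D) {W : Submodule K M} (hW : M.IsSubcomodule W) (h : W ≠ ⊥) :
    lin (M.subι W hW) ≠ 0 := fun h0 =>
  h <| by rw [← M.range_subι W hW, h0]; exact LinearMap.range_zero

/-- If `Y` is simple, then `S(Y)` has at most one simple subcomodule. -/
theorem simple_subcomodule_unique {Y : RightComod K (corner e)} (hY : Y.IsSimple)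
    {W W' : Submodule K ((sectionFunctor e).obj Y)}
    (hW : ((sectionFunctor e).obj Y).IsSubcomodule W)
    (hW' : ((sectionFunctor e).obj Y).IsSubcomodule W')
    (hs : (((sectionFunctor e).obj Y).sub W hW).IsSimple)
    (hs' : (((sectionFunctor e).obj Y).sub W' hW').IsSimple) : W = W' := by
  rw [isSimple_sub_iff] at hs hs'
  rcases hs.2 _ (hW.inf hW') inf_le_left with h | h
  · exfalso
    -- Every nonzero subcomodule `V` contains `e S(Y)`: its inclusion has a nonzero transpose `T(V)
    -- → Y`, surjective since `Y` is simple, and injectivity of the counit turns equality in `Y`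
    -- into equality in `e S(Y)`.
    have key : ∀ (V : Submodule K ((sectionFunctor e).obj Y))
        (hV : ((sectionFunctor e).obj Y).IsSubcomodule V), V ≠ ⊥ →
        ∀ x : (quotientFunctor e).obj ((sectionFunctor e).obj Y), Subtype.val x ∈ V := by
      intro V hV hne x
      obtain ⟨y, hy⟩ := hY.surjective _ (lin_transpose_ne_zero e
        (lin_subι_ne_zero _ hV hne)) (lin (counitHom e Y) x)
      have hy := counitHom_injective e Y hy
      rw [← hy]
      exact (Subtype.val y).2
    obtain ⟨y, hy⟩ := @exists_ne _ hY.1 0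
    obtain ⟨x, rfl⟩ := counitHom_surjective e Y y
    have hx : Subtype.val x ∈ W ⊓ W' := ⟨key W hW hs.1 x, key W' hW' hs'.1 x⟩
    rw [h] at hx
    exact hy ((congrArg _ (Subtype.ext ((Submodule.mem_bot K).1 hx))).trans (map_zero _))
  · exact (hs'.2 W hW (inf_eq_left.1 h)).resolve_left hs.1

theorem exists_transpose_eq_injective {M : RightComod K C} (hM : M.IsSimple)
    {N : RightComod K (corner e)} (f : (quotientFunctor e).obj M ⟶ N) (hf : lin f ≠ 0) :
    ∃ g : M ⟶ (sectionFunctor e).obj N, transpose e g = f ∧ Function.Injective (lin g) := by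
  obtain ⟨g, rfl⟩ := exists_transpose_eq e f
  exact ⟨g, rfl, hM.injective g (lin_ne_zero_of_transpose e hf)⟩

theorem lin_ne_zero_of_injective {D : Type v} [AddCommGroup D]
    [Module K D] [Coalgebra K D] {M N : RightComod K D} [Nontrivial M] (g : M ⟶ N)
    (hg : Function.Injective (lin g)) : lin g ≠ 0 := fun h => by
  obtain ⟨m, hm⟩ := exists_ne (0 : M)
  exact hm (hg ((LinearMap.congr_fun h m).trans (map_zero _).symm))

/-- The socle of `S(Y)` for a simple comodule `Y ≅ T(M)` with `M` simple. -/
theorem nonempty_socle_iso {Y : RightComod K (corner e)} (hY : Y.IsSimple) {M : RightComod K C}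
    (hM : M.IsSimple) (i : Y ≅ (quotientFunctor e).obj M) :
    Nonempty (((sectionFunctor e).obj Y).socle ≅ M) := by
  have := (hY.of_iso i).1
  obtain ⟨g, -, hg⟩ := exists_transpose_eq_injective e hM i.inv
    (lin_ne_zero_of_injective _ (linIso i).symm.injective)
  have hr := hM.of_iso (isoSubRange g hg)
  have hsoc := socleSubmodule_eq_of_unique (isSubcomodule_range g) hr fun V hV hVs =>
    simple_subcomodule_unique e hY hV _ hVs hr
  -- Isomorphism transported along an equality of subspaces, since the comodule `sub` also carries a
  -- proof about its subspace.
  have key : ∀ (V W : Submodule K ((sectionFunctor e).obj Y)) (h : V = W)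
      (hV : ((sectionFunctor e).obj Y).IsSubcomodule V)
      (hW : ((sectionFunctor e).obj Y).IsSubcomodule W),
      Nonempty (((sectionFunctor e).obj Y).sub V hV ≅ ((sectionFunctor e).obj Y).sub W hW) := by
    rintro V _ rfl _ _
    exact ⟨Iso.refl _⟩
  obtain ⟨k⟩ := key _ _ hsoc (isSubcomodule_sSup _ _ fun _ hW => hW.1) (isSubcomodule_range g)
  exact ⟨k ≪≫ (isoSubRange g hg).symm⟩

/-- Every simple `eCe`-comodule is `T(M)` for a simple `C`-comodule `M`. -/
theorem exists_simple_iso_quotObj {Y : RightComod K (corner e)} (hY : Y.IsSimple) :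
    ∃ M : RightComod K C, M.IsSimple ∧ ¬ IsTorsion e M ∧
      Nonempty (Y ≅ (quotientFunctor e).obj M) := by
  have := nontrivial_sectionObj e hY.1
  obtain ⟨W, hW, hs⟩ := exists_simple_subcomodule ((sectionFunctor e).obj Y)
  have hne := ((isSimple_sub_iff hW).1 hs).1
  have ht := fun h => hne (isTorsionFree_sectionObj e Y W hW h)
  obtain ⟨i⟩ := (isSimple_quotObj e hs ht).nonempty_iso hY _
    (lin_transpose_ne_zero e (lin_subι_ne_zero _ hW hne))
  exact ⟨_, hs, ht, ⟨i.symm⟩⟩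

theorem isTorsion_of_iso {M M' : RightComod K C} (i : M ≅ M') (h : IsTorsion e M) :
    IsTorsion e M' :=
  have : Subsingleton ((quotientFunctor e).obj M) := h
  (linIso ((quotientFunctor e).mapIso i)).symm.toEquiv.subsingleton

/-- The comodules `T(S_x) ≠ 0` form a complete set of pairwise non-isomorphic simple comodules. -/
theorem isCompleteSimples_quotObj {I : Type w} {S : I → RightComod K C}
    (hS : IsCompleteSimples S) : IsCompleteSimples
      (fun x : {x : I // ¬ IsTorsion e (S x)} => (quotientFunctor e).obj (S x)) where
  simple x := isSimple_quotObj e (hS.simple x) x.2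
  pairwise := by
    rintro ⟨x, hx⟩ ⟨y, hy⟩ ⟨i⟩
    -- `S_x` is recovered from `T(S_x)` as the socle of `S(T(S_x))`.
    have h := isSimple_quotObj e (hS.simple x) hx
    obtain ⟨k⟩ := nonempty_socle_iso e h (hS.simple x) (Iso.refl _)
    obtain ⟨l⟩ := nonempty_socle_iso e h (hS.simple y) i
    exact Subtype.ext (hS.pairwise x y ⟨k.symm ≪≫ l⟩)
  complete Y hY := by
    obtain ⟨M, hM, ht, ⟨i⟩⟩ := exists_simple_iso_quotObj e hY
    obtain ⟨x, ⟨k⟩⟩ := hS.complete M hM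
    exact ⟨⟨x, fun h => ht (isTorsion_of_iso e k.symm h)⟩, ⟨i ≪≫ (quotientFunctor e).mapIso k⟩⟩

/-! ### Injective comodules -/

/-- Monomorphisms are the injective morphisms, and `T` merely restricts a map to `eM`. -/
instance : (quotientFunctor e).PreservesMonomorphisms where
  preserves f _ := mono_of_injective _ fun _ _ h =>
    Subtype.ext (injective_of_mono f (congrArg Subtype.val h))

theorem injective_sectionObj {N : RightComod K (corner e)} (h : Injective N) :
    Injective ((sectionFunctor e).obj N) :=
  (quotientSectionAdj e).map_injective N h

/-- If `T(M) ⟶ E` is an injective envelope and `M` is simple, then so is the adjoint morphism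
`M ⟶ S(E)`. -/
theorem exists_isInjectiveEnvelope_sectionObj {M : RightComod K C} (hM : M.IsSimple)
    (ht : ¬ IsTorsion e M) {E : RightComod K (corner e)} {j : (quotientFunctor e).obj M ⟶ E}
    (hj : IsInjectiveEnvelope j) :
    ∃ g : M ⟶ (sectionFunctor e).obj E, IsInjectiveEnvelope g := by
  have := (nontrivial_quotObj_iff e).2 ht
  obtain ⟨g, rfl, hg⟩ := exists_transpose_eq_injective e hM j
    (lin_ne_zero_of_injective _ hj.injective_map)
  refine ⟨g, injective_sectionObj e hj.injective_obj, hg, fun W hW h => ?_⟩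
  by_contra hne
  refine lin_transpose_ne_zero e (lin_subι_ne_zero _ hW hne) (LinearMap.range_eq_bot.1
    (hj.essential _ (isSubcomodule_range _) ?_))
  rw [eq_bot_iff]
  -- A common value in `E` of the transposes of `W ⊆ S(E)` and of `g` comes, by injectivity of the
  -- counit, from one element of `e S(E)`. That element lies in `W` and in the image of `g`, hence
  -- is zero.
  rintro _ ⟨⟨x, rfl⟩, y, hy⟩
  have hxy := congrArg Subtype.val (counitHom_injective e E hy)
  have h0 : (Subtype.val x).1 ∈ W ⊓ LinearMap.range (lin g) :=
    ⟨(Subtype.val x).2, Subtype.val y, hxy⟩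
  rw [h] at h0
  have hx : x = 0 := Subtype.ext (Subtype.ext h0)
  rw [hx]
  exact map_zero _

/-! ### Quasi-finite comodules -/

/-- The map `Hom(F, S(N)) → Hom(T(F), N)` of the adjunction is linear. -/
def transposeLin (F : RightComod K C) (N : RightComod K (corner e)) :
    homs F ((sectionFunctor e).obj N) →ₗ[K] homs ((quotientFunctor e).obj F) N where
  toFun g := transpose e g
  map_add' g g' := Subtype.ext <| LinearMap.ext fun x =>
    map_add (contract N (rightCounit e) ∘ₗ lin (sectionι e N)) (g.1 x.1) (g'.1 x.1)
  map_smul' a g := Subtype.ext <| LinearMap.ext fun x =>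
    map_smul (contract N (rightCounit e) ∘ₗ lin (sectionι e N)) a (g.1 x.1)

/-- `Hom(F, S(N))` embeds linearly in `Hom(T(F), N)`, and `T(F) = eF` is finite-dimensional along
with `F`. -/
theorem isQuasiFinite_sectionObj {N : RightComod K (corner e)} (h : N.IsQuasiFinite) :
    ((sectionFunctor e).obj N).IsQuasiFinite := fun F hF => by
  have : Module.Finite K ((quotientFunctor e).obj F) :=
    inferInstanceAs (Module.Finite K (actRange e F))
  have := h ((quotientFunctor e).obj F) this
  exact Module.Finite.of_injective (transposeLin e F N) (transpose_injective e)

theorem isIndecomposable_sectionObj {N : RightComod K (corner e)} (h : N.IsIndecomposable) :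
    ((sectionFunctor e).obj N).IsIndecomposable :=
  isIndecomposable_obj_of_fullyFaithful _ h (nontrivial_sectionObj e h.1)

end ComodLoc

end

/-! ### Assembly of the statements (a) to (h) -/

theorem mainTheorem12 {K : Type u} {C : Type v} [Field K] [AddCommGroup C] [Module K C]
    [Coalgebra K C] (e : DualIdempotent K C) {I : Type w} (Sx : I → RightComod K C)
    (hSx : RightComod.IsCompleteSimples Sx) :
    -- the comodules `S_x = T(S_x)`, `x ∈ I_e`, are the simple right `eCe`-comodules
    RightComod.IsCompleteSimples
      (fun x : {x : I // ¬ IsTorsion e (Sx x)} => (quotientFunctor e).obj (Sx x)) ∧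
    -- (a)
    (∀ N : RightComod K (corner e), Injective N → Injective ((sectionFunctor e).obj N)) ∧
    -- (b)
    (∀ N : RightComod K (corner e), N.IsQuasiFinite → N.IsIndecomposable →
      ((sectionFunctor e).obj N).IsIndecomposable) ∧
    -- (c)
    (∀ N : RightComod K (corner e), Injective N → N.IsIndecomposable →
      Injective ((sectionFunctor e).obj N) ∧ ((sectionFunctor e).obj N).IsIndecomposable) ∧
    -- (d)
    (∀ Y : RightComod K (corner e), Y.IsSimple →
      ∀ x : I, Nonempty (Y ≅ (quotientFunctor e).obj (Sx x)) →
        Nonempty (((sectionFunctor e).obj Y).socle ≅ Sx x)) ∧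
    -- (e)
    (∀ Y : RightComod K (corner e), Y.IsSimple → IsTorsionFree e ((sectionFunctor e).obj Y)) ∧
    -- (f)
    (∀ x : I, ¬ IsTorsion e (Sx x) →
      ∀ (E : RightComod K C) (j : Sx x ⟶ E), RightComod.IsInjectiveEnvelope j →
      ∀ (E' : RightComod K (corner e)) (j' : (quotientFunctor e).obj (Sx x) ⟶ E'),
        RightComod.IsInjectiveEnvelope j' → Nonempty ((sectionFunctor e).obj E' ≅ E)) ∧
    -- (g) and (h)
    (∃ hqf : ∀ N : RightComod K (corner e), N.IsQuasiFinite →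
        ((sectionFunctor e).obj N).IsQuasiFinite,
      (sectionFunctorQF e hqf).Full ∧ (sectionFunctorQF e hqf).Faithful ∧
      (∀ N, N.obj.IsIndecomposable → ((sectionFunctorQF e hqf).obj N).obj.IsIndecomposable) ∧
      (∀ N N', Nonempty ((sectionFunctorQF e hqf).obj N ≅ (sectionFunctorQF e hqf).obj N') ↔ Nonempty (N ≅ N'))) := by
  refine ⟨isCompleteSimples_quotObj e hSx, fun N hN => injective_sectionObj e hN,
    fun N _ hN => isIndecomposable_sectionObj e hN,
    fun N hN hi => ⟨injective_sectionObj e hN, isIndecomposable_sectionObj e hi⟩,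
    fun Y hY x ⟨i⟩ => nonempty_socle_iso e hY (hSx.simple x) i,
    fun Y _ => isTorsionFree_sectionObj e Y, ?_,
    fun N hN => isQuasiFinite_sectionObj e hN, ?_⟩
  · intro x hx E j hj E' j' hj'
    obtain ⟨g, hg⟩ := exists_isInjectiveEnvelope_sectionObj e (hSx.simple x) hx hj'
    exact hg.nonempty_iso hj
  · have hfull : (sectionFunctorQF e fun N hN => isQuasiFinite_sectionObj e hN).Full := by
      unfold sectionFunctorQF
      infer_instance
    have hfaithful : (sectionFunctorQF e fun N hN => isQuasiFinite_sectionObj e hN).Faithful := by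
      unfold sectionFunctorQF
      infer_instance
    exact ⟨hfull, hfaithful, fun N hN => isIndecomposable_sectionObj e hN,
      -- A fully faithful functor lifts isomorphisms between images to isomorphisms of the sources.
      fun N N' => ⟨fun ⟨i⟩ => ⟨Functor.preimageIso _ i⟩, fun ⟨i⟩ => ⟨Functor.mapIso _ i⟩⟩⟩
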